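/- Let $\mu>-\tfrac12$ be real and let $L^2_\mu(\mathbb R)$ be the Hilbert space of measurable $f:\mathbb R\to\mathbb C$ with $\int_{\mathbb R}|f(x)|^2|x|^{2\mu}\,dx<\infty$. Put $$\gamma_\mu(2m)=\frac{2^{2m}m!\,\Gamma(m+\mu+\frac12)}{\Gamma(\mu+\frac12)},\qquad \gamma_\mu(2m+1)=\frac{2^{2m+1}m!\,\Gamma(m+\mu+\frac32)}{\Gamma(\mu+\frac12)},\qquad \mathbf e_\mu(z)=\sum_{m\ge 0}\frac{z^m}{\gamma_\mu(m)},$$ let $H_n^\mu(x)=n!\sum_{0\le k\le n/2}\frac{(-1)^k(2x)^{n-2k}}{k!\,\gamma_\mu(n-2k)}$ be the generalized Hermite polynomials and $$\phi_n^\mu(x)=\Big(\frac{\gamma_\mu(n)}{\Gamma(\mu+\frac12)}\Big)^{1/2}\frac{1}{2^{n/2}\,n!}\,e^{-x^2/2}H_n^\mu(x)$$ the generalized Hermite functions. On the finite linear span of the $\phi_n^\mu$ ($n\ge0$) put $$P_\mu f(x)=-i\Big(f'(x)+\frac{\mu}{x}\big(f(x)-f(-x)\big)\Big),$$ and denote by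 $P_\mu$ also the closure of this operator in $L^2_\mu(\mathbb R)$. Then $P_\mu$ is self-adjoint, and for every $t>0$ and every $f\in L^2_\mu(\mathbb R)$ the integral $$(T_\mu(t)f)(x)=\frac{1}{(4t)^{\mu+1/2}\,\Gamma(\mu+\frac12)}\int_{\mathbb R}\exp\Big(-\frac{x^2+y^2}{4t}\Big)\,\mathbf e_\mu\Big(\frac{xy}{2t}\Big)f(y)\,|y|^{2\mu}\,dy$$ converges absolutely for every $x\in\mathbb R$, and $$T_\mu(t)f=\exp(-tP_\mu^2)f\quad\text{in }L^2_\mu(\mathbb R),$$ where $\exp(-tP_\mu^2)=\int_{\mathbb R}e^{-t\lambda^2}\,dE(\lambda)$ with $E$ the spectral measure of $P_\mu$. In particular $T_\mu(t)$, $t>0$, is a semigroup of bounded operators, $T_\mu(s+t)=T_\mu(s)T_\mu(t)$, with $T_\mu(t)f\to f$ in $L^2_\mu(\mathbb R)$ as $t\downarrow0$ (the generalized Gauss–Weierstrass heat semigroup). -/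

import Mathlib

open MeasureTheory Filter Topology
open scoped ENNReal Nat InnerProductSpace

noncomputable section

/-! ## Spectral measures and functions of an unbounded self-adjoint operator -/

section Spectral

variable {H : Type*} [NormedAddCommGroup H] [InnerProductSpace ℂ H] [CompleteSpace H]

/-- A spectral measure (projection-valued measure, resolution of the identity) on the Borel sets
of the real line, with values in the orthogonal projections of the Hilbert space `H`. The values
of `proj` on sets that are not measurable are irrelevant. -/
structure SpectralMeasure (H : Type*) [NormedAddCommGroup H] [InnerProductSpace ℂ H]
    [CompleteSpace H] where
  /-- The projection attached to a Borel set. -/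
  proj : Set ℝ → H →L[ℂ] H
  isStarProjection_proj : ∀ s, MeasurableSet s → IsStarProjection (proj s)
  proj_univ : proj Set.univ = 1
  proj_inter : ∀ s t, MeasurableSet s → MeasurableSet t → proj (s ∩ t) = proj s * proj t
  hasSum_proj_iUnion : ∀ s : ℕ → Set ℝ, (∀ i, MeasurableSet (s i)) →
    Pairwise (Function.onFun Disjoint s) →
      ∀ x : H, HasSum (fun i => proj (s i) x) (proj (⋃ i, s i) x)

namespace SpectralMeasure

theorem proj_empty_apply (E : SpectralMeasure H) (x : H) : E.proj ∅ x = 0 := by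
  have h := E.hasSum_proj_iUnion (fun _ => ∅) (fun _ => MeasurableSet.empty)
    (fun _ _ _ => by simp [Function.onFun]) x
  exact (summable_const_iff _).1 h.summable

theorem re_inner_proj_nonneg (E : SpectralMeasure H) {s : Set ℝ} (hs : MeasurableSet s) (x : H) :
    0 ≤ (⟪x, E.proj s x⟫_ℂ).re := by
  have h := E.isStarProjection_proj s hs
  have h1 : E.proj s x = E.proj s (E.proj s x) := by
    conv_lhs => rw [← h.isIdempotentElem.eq]
    rfl
  have h2 : ⟪x, E.proj s x⟫_ℂ = ⟪E.proj s x, E.proj s x⟫_ℂ := by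
    have h3 := ContinuousLinearMap.adjoint_inner_left (E.proj s) (E.proj s x) x
    rw [← ContinuousLinearMap.star_eq_adjoint, h.isSelfAdjoint.star_eq, ← h1] at h3
    exact h3.symm
  rw [h2]
  exact inner_self_nonneg (𝕜 := ℂ)

/-- The finite Borel measure `s ↦ ⟪x, E(s) x⟫ = ‖E(s) x‖²`. -/
def diag (E : SpectralMeasure H) (x : H) : Measure ℝ :=
  Measure.ofMeasurable (fun s _ => ENNReal.ofReal (⟪x, E.proj s x⟫_ℂ).re)
    (by simp [E.proj_empty_apply x])
    (by
      intro s hs hd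
      have h := E.hasSum_proj_iUnion s hs hd x
      have h2 : HasSum (fun i => (⟪x, E.proj (s i) x⟫_ℂ).re)
          (⟪x, E.proj (⋃ i, s i) x⟫_ℂ).re :=
        Complex.hasSum_re (h.mapL (innerSL ℂ x))
      rw [← h2.tsum_eq]
      exact ENNReal.ofReal_tsum_of_nonneg (fun i => E.re_inner_proj_nonneg (hs i) x) h2.summable)

/-- `E` is the spectral measure of the operator `A`, i.e. `A = ∫ l dE(l)`: the domain of `A`
consists of the vectors `x` with `∫ l² d⟪x, E x⟫ < ∞`, and there
`⟪x, A x⟫ = ∫ l d⟪x, E x⟫`. (By polarization the diagonal values determine `A`.) -/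
def IsSpectralMeasureOf (E : SpectralMeasure H) (A : H →ₗ.[ℂ] H) : Prop :=
  (∀ x : H, x ∈ A.domain ↔ Integrable (fun l : ℝ => l ^ 2) (E.diag x)) ∧
    ∀ x : A.domain, ⟪(x : H), A x⟫_ℂ = ((∫ l : ℝ, l ∂(E.diag (x : H)) : ℝ) : ℂ)

/-- `B = ∫ f(l) dE(l)` for a bounded Borel function `f`. (By polarization the diagonal values
determine `B`.) -/
def IsIntegral (E : SpectralMeasure H) (f : ℝ → ℝ) (B : H →L[ℂ] H) : Prop :=
  ∀ x : H, ⟪x, B x⟫_ℂ = ((∫ l : ℝ, f l ∂(E.diag x) : ℝ) : ℂ)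

end SpectralMeasure

/-- For a self-adjoint operator `A` and a bounded Borel function `f`: the bounded operator `B` is
`f(A)` in the sense of the functional calculus, i.e. `B = ∫ f dE` with `E` the spectral measure
of `A`. -/
def IsBorelFunctionOf (A : H →ₗ.[ℂ] H) (f : ℝ → ℝ) (B : H →L[ℂ] H) : Prop :=
  ∃ E : SpectralMeasure H, E.IsSpectralMeasureOf A ∧ E.IsIntegral f B

end Spectral

/-! ## The generalized exponential, Hermite functions and the operator `P` -/

namespace BoseLike

/-- The measure `|t|^{2μ} dt` on the real line. -/
def weightMeasure (μ : ℝ) : Measure ℝ :=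
  volume.withDensity fun t => ENNReal.ofReal (|t| ^ (2 * μ))

/-- The complex Hilbert space of the functions that are square integrable against
`|t|^{2μ} dt`. -/
abbrev L2 (μ : ℝ) : Type := Lp ℂ 2 (weightMeasure μ)

/-- The generalized factorial: `γ(2m) = 2^{2m} m! Γ(m+μ+1/2) / Γ(μ+1/2)` and
`γ(2m+1) = 2^{2m+1} m! Γ(m+μ+3/2) / Γ(μ+1/2)`. -/
def genFactorial (μ : ℝ) (n : ℕ) : ℝ :=
  2 ^ n * ((n / 2)! : ℝ) * Real.Gamma (((n + 1) / 2 : ℕ) + μ + 1 / 2) / Real.Gamma (μ + 1 / 2)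

/-- The generalized exponential, the entire function `e_μ(z) = ∑ zᵐ / γ_μ(m)`. -/
def genExp (μ : ℝ) (z : ℂ) : ℂ :=
  ∑' m : ℕ, z ^ m / (genFactorial μ m : ℂ)

/-- The generalized Hermite polynomials
`H_n(x) = n! ∑_{k ≤ n/2} (-1)^k (2x)^{n-2k} / (k! γ_μ(n-2k))`. -/
def genHermite (μ : ℝ) (n : ℕ) (x : ℝ) : ℝ :=
  (n ! : ℝ) * ∑ k ∈ Finset.range (n / 2 + 1),
    (-1) ^ k * (2 * x) ^ (n - 2 * k) / ((k ! : ℝ) * genFactorial μ (n - 2 * k))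

/-- The (normalized) generalized Hermite functions, as functions on the line. -/
def hermiteFun (μ : ℝ) (n : ℕ) (x : ℝ) : ℂ :=
  ((Real.sqrt (genFactorial μ n / Real.Gamma (μ + 1 / 2)) / (2 ^ ((n : ℝ) / 2) * (n ! : ℝ)) *
    Real.exp (-x ^ 2 / 2) * genHermite μ n x : ℝ) : ℂ)

/-- The finite linear span of the generalized Hermite functions. -/
def hermiteSpan (μ : ℝ) : Submodule ℂ (ℝ → ℂ) :=
  Submodule.span ℂ (Set.range (hermiteFun μ))

/-- The differential-difference expression `-i (f'(x) + (μ/x) (f(x) - f(-x)))`. Its value at the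
single point `x = 0` plays no role below. -/
def momentumExpr (μ : ℝ) (f : ℝ → ℂ) (x : ℝ) : ℂ :=
  -Complex.I * (deriv f x + ((μ / x : ℝ) : ℂ) * (f x - f (-x)))

theorem differentiable_hermiteFun (μ : ℝ) (n : ℕ) : Differentiable ℝ (hermiteFun μ n) := by
  have h : Differentiable ℝ (fun x : ℝ =>
      Real.sqrt (genFactorial μ n / Real.Gamma (μ + 1 / 2)) / (2 ^ ((n : ℝ) / 2) * (n ! : ℝ)) *
        Real.exp (-x ^ 2 / 2) * genHermite μ n x) := by
    unfold genHermite
    fun_prop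
  exact Complex.ofRealCLM.differentiable.comp h

theorem differentiable_of_mem_hermiteSpan {μ : ℝ} {g : ℝ → ℂ} (hg : g ∈ hermiteSpan μ) :
    Differentiable ℝ g := by
  induction hg using Submodule.span_induction with
  | mem x hx => obtain ⟨n, rfl⟩ := hx; exact differentiable_hermiteFun μ n
  | zero => exact differentiable_const (0 : ℂ)
  | add x y _ _ hx hy => exact hx.add hy
  | smul a x _ hx => exact hx.const_smul a

/-- The graph of `P` on the finite span of the generalized Hermite functions, as a subspace of
`L2 μ × L2 μ`. -/
def momentumGraph (μ : ℝ) : Submodule ℂ (L2 μ × L2 μ) where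
  carrier := {p | ∃ g ∈ hermiteSpan μ, p.1 =ᵐ[weightMeasure μ] g ∧
    p.2 =ᵐ[weightMeasure μ] momentumExpr μ g}
  add_mem' := by
    rintro p q ⟨g, hg, hp1, hp2⟩ ⟨h, hh, hq1, hq2⟩
    refine ⟨g + h, add_mem hg hh, ?_, ?_⟩
    · exact (Lp.coeFn_add _ _).trans (hp1.add hq1)
    · refine (Lp.coeFn_add _ _).trans ((hp2.add hq2).trans (Eventually.of_forall fun x => ?_))
      have hd : deriv (g + h) x = deriv g x + deriv h x :=
        deriv_add (differentiable_of_mem_hermiteSpan hg x) (differentiable_of_mem_hermiteSpan hh x)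
      simp only [Pi.add_apply, momentumExpr, hd]
      ring
  zero_mem' := by
    refine ⟨0, zero_mem _, Lp.coeFn_zero _ _ _, ?_⟩
    refine (Lp.coeFn_zero _ _ _).trans (Eventually.of_forall fun x => ?_)
    simp [momentumExpr]
  smul_mem' := by
    rintro c p ⟨g, hg, hp1, hp2⟩
    refine ⟨c • g, Submodule.smul_mem _ c hg, ?_, ?_⟩
    · exact (Lp.coeFn_smul _ _).trans (hp1.const_smul c)
    · refine (Lp.coeFn_smul _ _).trans ((hp2.const_smul c).trans (Eventually.of_forall fun x => ?_))
      have hd : deriv (c • g) x = c • deriv g x :=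
        deriv_const_smul c (differentiable_of_mem_hermiteSpan hg x)
      simp only [Pi.smul_apply, momentumExpr, hd, smul_eq_mul]
      ring

theorem volume_absolutelyContinuous_weightMeasure (μ : ℝ) : volume ≪ weightMeasure μ := by
  unfold weightMeasure
  refine withDensity_absolutelyContinuous' (by fun_prop) ?_
  have h : ∀ᵐ t : ℝ, t ≠ 0 := by simp [ae_iff, measure_singleton]
  filter_upwards [h] with t ht
  have : 0 < |t| ^ (2 * μ) := Real.rpow_pos_of_pos (abs_pos.2 ht) _
  simpa using this

/-- The graph above is single-valued. -/
theorem momentumGraph_functional (μ : ℝ) (p : L2 μ × L2 μ) (hp : p ∈ momentumGraph μ)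
    (h0 : p.1 = 0) : p.2 = 0 := by
  obtain ⟨g, hg, h1, h2⟩ := hp
  have hg0 : g =ᵐ[volume] (0 : ℝ → ℂ) := by
    apply (volume_absolutelyContinuous_weightMeasure μ).ae_le
    rw [h0] at h1
    exact h1.symm.trans (Lp.coeFn_zero _ _ _)
  have hg1 : g = 0 := Measure.eq_of_ae_eq hg0
    (differentiable_of_mem_hermiteSpan hg).continuous continuous_const
  rw [Lp.eq_zero_iff_ae_eq_zero]
  refine h2.trans (Eventually.of_forall fun x => ?_)
  simp [momentumExpr, hg1]

/-- `P` on the finite span of the generalized Hermite functions. -/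
def momentumCore (μ : ℝ) : L2 μ →ₗ.[ℂ] L2 μ := (momentumGraph μ).toLinearPMap

theorem momentumCore_graph (μ : ℝ) : (momentumCore μ).graph = momentumGraph μ :=
  Submodule.toLinearPMap_graph_eq _ (momentumGraph_functional μ)

/-- The operator `P`: the closure of its restriction to the finite span of the generalized Hermite
functions. -/
def momentum (μ : ℝ) : L2 μ →ₗ.[ℂ] L2 μ := (momentumCore μ).closure

/-- The function `(4t)^{-μ-1/2} Γ(μ+1/2)⁻¹ exp(-(x²+y²)/(4t)) e_μ(xy/(2t))`. -/
def heatKernel (μ t x y : ℝ) : ℂ :=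
  ((1 / ((4 * t) ^ (μ + 1 / 2) * Real.Gamma (μ + 1 / 2)) *
    Real.exp (-(x ^ 2 + y ^ 2) / (4 * t)) : ℝ) : ℂ) * genExp μ ((x * y / (2 * t) : ℝ) : ℂ)

/-- The integrand of the integral operator `T_μ(t)` applied to `f`, at the point `x`. -/
def heatIntegrand (μ t : ℝ) (f : ℝ → ℂ) (x y : ℝ) : ℂ :=
  heatKernel μ t x y * f y * ((|y| ^ (2 * μ) : ℝ) : ℂ)

/-- The integral operator `T_μ(t)`. -/
def heatOperator (μ t : ℝ) (f : ℝ → ℂ) (x : ℝ) : ℂ :=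
  ∫ y, heatIntegrand μ t f x y

end BoseLike

end

/-! Write ψ_n for `hermiteBase μ n`, the Hermite functions scaled so that ∑ zⁿ ψ_n(x) = G_z(x) =
exp(-x²/2 - z²) e_μ(2xz), and θ for `dunklFactor μ`, the ratio of consecutive generalized
factorials. The proof diagonalizes P explicitly by the generalized Fourier (Dunkl) transform U, the
unitary operator with U ψ_n = (-i)ⁿ ψ_n.

U exists because the ψ_n form an orthogonal basis. Orthogonality (`hermiteGram_eq`) follows from the
three-term recurrence for 2x ψ_n and the moments of the Gaussian; completeness
(`ae_eq_zero_of_hermiteBase_orthogonal`) from the fact that a density with exponential moments is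
determined by its moments. Multiplication by x and the operator iP both send ψ_n to a combination of
ψ_{n-1} and ψ_{n+1}, with the same coefficients up to one sign. The phases (-i)ⁿ repair that sign,
so U P = x U on the span (`dunklTransform_momentumVec`). The range of P + i on the span is dense,
again by completeness, and ‖(P + i)f‖ controls the graph norm, so the closure of P is the whole
operator U⁻¹ x U (`momentum_graph`). Self-adjointness, the spectral measure, exp(-tP²) = U⁻¹ exp(-t
x²) U, the semigroup law and strong continuity are then facts about multiplication operators.

It remains to identify exp(-tP²) with the integral operator. Computing ⟨G_w, G_z⟩ by orthogonality
yields the Weber integral of exp(-s x²) e_μ(ax) e_μ(bx) against the weight. It gives T(t) G_z in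
closed form (`heatOperator_genVec`), and since U G_z = G_{-iz} it also evaluates the pairings of
exp(-tP²) G_z with every G_w; the two agree (`integral_genFun_mul_heatGenFun`). The G_z span a dense
subspace, as the ψ_n are the Taylor coefficients of z ↦ G_z. Agreement passes to the closure: for
fixed x, (T(t)f)(x) is an inner product, hence continuous in f, and L² limits are almost everywhere
limits along a subsequence (`isClosed_heatAgree`). -/

noncomputable section

namespace BoseLike

/-! ### The generalized factorial -/

/-- The quotient `γ(n) / γ(n - 1)`. -/
def dunklFactor (μ : ℝ) (n : ℕ) : ℝ := n + if Odd n then 2 * μ else 0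

theorem dunklFactor_zero (μ : ℝ) : dunklFactor μ 0 = 0 := by simp [dunklFactor]

/-- Together with θ(0) = 0, this is all that the recurrences for `gaussConv` use of θ: the series of
exp(-z²) has even terms only. -/
theorem dunklFactor_even_add (μ : ℝ) {j : ℕ} (hj : Even j) (m : ℕ) :
    dunklFactor μ (j + m) = j + dunklFactor μ m := by
  have h : Odd (j + m) ↔ Odd m := by
    rw [Nat.odd_add']; simp [hj]
  simp only [dunklFactor, h]
  push_cast
  ring

theorem dunklFactor_succ_pos {μ : ℝ} (hμ : -(1 / 2) < μ) (n : ℕ) : 0 < dunklFactor μ (n + 1) := by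
  unfold dunklFactor
  have : (0 : ℝ) ≤ n := n.cast_nonneg
  split_ifs <;> push_cast <;> linarith

theorem Gamma_half_pos {μ : ℝ} (hμ : -(1 / 2) < μ) : 0 < Real.Gamma (μ + 1 / 2) :=
  Real.Gamma_pos_of_pos (by linarith)

theorem genFactorial_pos {μ : ℝ} (hμ : -(1 / 2) < μ) (n : ℕ) : 0 < genFactorial μ n := by
  have h1 := Gamma_half_pos hμ
  have h2 : 0 < Real.Gamma (((n + 1) / 2 : ℕ) + μ + 1 / 2) := by
    apply Real.Gamma_pos_of_pos
    have : (0 : ℝ) ≤ ((n + 1) / 2 : ℕ) := Nat.cast_nonneg _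
    linarith
  unfold genFactorial
  positivity

theorem genFactorial_zero {μ : ℝ} (hμ : -(1 / 2) < μ) : genFactorial μ 0 = 1 := by
  have h1 := (Gamma_half_pos hμ).ne'
  simp only [genFactorial]
  norm_num
  norm_num at h1
  exact h1

theorem genFactorial_succ {μ : ℝ} (hμ : -(1 / 2) < μ) (n : ℕ) :
    genFactorial μ (n + 1) = dunklFactor μ (n + 1) * genFactorial μ n := by
  have h1 := (Gamma_half_pos hμ).ne'
  rcases Nat.even_or_odd' n with ⟨m, rfl | rfl⟩
  · have e1 : (2 * m + 1) / 2 = m := by omega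
    have e2 : (2 * m + 1 + 1) / 2 = m + 1 := by omega
    have e3 : (2 * m) / 2 = m := by omega
    have e4 : Real.Gamma (((m + 1 : ℕ) : ℝ) + μ + 1 / 2) =
        (m + μ + 1 / 2) * Real.Gamma (m + μ + 1 / 2) := by
      rw [← Real.Gamma_add_one]
      · congr 1; push_cast; ring
      · have : (0 : ℝ) ≤ m := m.cast_nonneg
        linarith
    have e5 : dunklFactor μ (2 * m + 1) = 2 * (m + μ + 1 / 2) := by
      simp [dunklFactor]; ring
    simp only [genFactorial, e1, e2, e3, e4, e5]
    ring
  · have e1 : (2 * m + 1) / 2 = m := by omega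
    have e2 : (2 * m + 1 + 1) / 2 = m + 1 := by omega
    have e3 : (2 * m + 1 + 1 + 1) / 2 = m + 1 := by omega
    have e5 : dunklFactor μ (2 * m + 1 + 1) = 2 * (m + 1) := by
      have : ¬ Odd (2 * m + 1 + 1) := by
        rw [Nat.not_odd_iff_even]; exact ⟨m + 1, by ring⟩
      simp [dunklFactor, this]; ring
    simp only [genFactorial, e1, e2, e3, e5, Nat.factorial_succ]
    push_cast
    ring

/-- Dominates every series in 1/γ by an exponential series. All factors θ(n+1) with n ≥ 1 are at
least (n+1)/2; only θ(1) = 1 + 2μ can be arbitrarily small, and it is absorbed in the constant. -/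
theorem exists_inv_genFactorial_le {μ : ℝ} (hμ : -(1 / 2) < μ) :
    ∃ C : ℝ, 0 < C ∧ ∀ n, 1 / genFactorial μ n ≤ C * (2 ^ n / (n ! : ℝ)) := by
  have hd : 0 < 1 + 2 * μ := by linarith
  have hC : 0 < max 1 (1 / (1 + 2 * μ)) := lt_max_of_lt_left one_pos
  refine ⟨max 1 (1 / (1 + 2 * μ)), hC, fun n => ?_⟩
  induction n with
  | zero => simp [genFactorial_zero hμ]
  | succ n ih =>
    have hg := genFactorial_pos hμ n
    have hg' := dunklFactor_succ_pos hμ n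
    rcases Nat.eq_zero_or_pos n with rfl | hn
    · rw [genFactorial_succ hμ, genFactorial_zero hμ]
      have : dunklFactor μ (0 + 1) = 1 + 2 * μ := by simp [dunklFactor]
      rw [this, mul_one]
      have h2 := le_max_right 1 (1 / (1 + 2 * μ))
      refine h2.trans ?_
      norm_num
    · have h2 : ((n : ℝ) + 1) / 2 ≤ dunklFactor μ (n + 1) := by
        have : (1 : ℝ) ≤ n := by exact_mod_cast hn
        unfold dunklFactor
        split_ifs with h
        · have : (2 : ℝ) ≤ n := by
            have : n ≠ 1 := by rintro rfl; revert h; decide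
            exact_mod_cast (by omega : 2 ≤ n)
          push_cast; linarith
        · push_cast; linarith
      have hn1 : (0 : ℝ) < n + 1 := by positivity
      calc 1 / genFactorial μ (n + 1)
          = (1 / dunklFactor μ (n + 1)) * (1 / genFactorial μ n) := by
            rw [genFactorial_succ hμ]; field_simp
        _ ≤ (1 / (((n : ℝ) + 1) / 2)) * (max 1 (1 / (1 + 2 * μ)) * (2 ^ n / (n ! : ℝ))) := by
            gcongr
        _ = _ := by
            rw [Nat.factorial_succ]; push_cast; field_simp; ring

/-! ### The generalized exponential -/

theorem norm_pow_div_genFactorial_le {μ C : ℝ} (hμ : -(1 / 2) < μ)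
    (hC : ∀ n, 1 / genFactorial μ n ≤ C * (2 ^ n / (n ! : ℝ))) (z : ℂ) (n : ℕ) :
    ‖z ^ n / (genFactorial μ n : ℂ)‖ ≤ C * ((2 * ‖z‖) ^ n / (n ! : ℝ)) := by
  have hg := genFactorial_pos hμ n
  rw [norm_div, norm_pow, Complex.norm_real, Real.norm_of_nonneg hg.le]
  calc ‖z‖ ^ n / genFactorial μ n = ‖z‖ ^ n * (1 / genFactorial μ n) := by ring
    _ ≤ ‖z‖ ^ n * (C * (2 ^ n / (n ! : ℝ))) := by gcongr; exact hC n
    _ = _ := by rw [mul_pow]; ring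

theorem summable_norm_genExp {μ : ℝ} (hμ : -(1 / 2) < μ) (z : ℂ) :
    Summable fun n : ℕ => ‖z ^ n / (genFactorial μ n : ℂ)‖ := by
  obtain ⟨C, hC, h⟩ := exists_inv_genFactorial_le hμ
  exact Summable.of_nonneg_of_le (fun _ => norm_nonneg _) (norm_pow_div_genFactorial_le hμ h z)
    ((Real.summable_pow_div_factorial _).mul_left C)

theorem hasSum_genExp {μ : ℝ} (hμ : -(1 / 2) < μ) (z : ℂ) :
    HasSum (fun n : ℕ => z ^ n / (genFactorial μ n : ℂ)) (genExp μ z) :=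
  (summable_norm_genExp hμ z).of_norm.hasSum

theorem exists_norm_genExp_le {μ : ℝ} (hμ : -(1 / 2) < μ) :
    ∃ C : ℝ, 0 < C ∧ ∀ z, ‖genExp μ z‖ ≤ C * Real.exp (2 * ‖z‖) := by
  obtain ⟨C, hC, h⟩ := exists_inv_genFactorial_le hμ
  refine ⟨C, hC, fun z => ?_⟩
  have h1 : HasSum (fun n : ℕ => C * ((2 * ‖z‖) ^ n / (n ! : ℝ))) (C * Real.exp (2 * ‖z‖)) := by
    rw [Real.exp_eq_exp_ℝ]
    exact (NormedSpace.expSeries_div_hasSum_exp (2 * ‖z‖)).mul_left C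
  exact tsum_of_norm_bounded h1 (norm_pow_div_genFactorial_le hμ h z)

theorem measurable_genExp {μ : ℝ} (hμ : -(1 / 2) < μ) : Measurable (genExp μ) := by
  refine measurable_of_tendsto_metrizable
    (f := fun n z => ∑ i ∈ Finset.range n, z ^ i / (genFactorial μ i : ℂ)) (fun n => by fun_prop) ?_
  rw [tendsto_pi_nhds]
  exact fun z => (hasSum_genExp hμ z).tendsto_sum_nat

theorem conj_genExp (μ : ℝ) (z : ℂ) :
    (starRingEnd ℂ) (genExp μ z) = genExp μ ((starRingEnd ℂ) z) := by
  unfold genExp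
  rw [Complex.conj_tsum]
  simp

/-! ### The Hermite coefficients -/

/-- The Taylor coefficients of `exp (-z ^ 2)`. -/
def gaussCoeff : ℕ → ℝ
  | 0 => 1
  | 1 => 0
  | (n + 2) => -2 / (n + 2) * gaussCoeff n

theorem gaussCoeff_odd (k : ℕ) : gaussCoeff (2 * k + 1) = 0 := by
  induction k with
  | zero => rfl
  | succ k ih =>
    rw [show 2 * (k + 1) + 1 = (2 * k + 1) + 2 by ring, gaussCoeff, ih, mul_zero]

theorem gaussCoeff_even (k : ℕ) : gaussCoeff (2 * k) = (-1) ^ k / (k ! : ℝ) := by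
  induction k with
  | zero => simp [gaussCoeff]
  | succ k ih =>
    rw [show 2 * (k + 1) = (2 * k) + 2 by ring, gaussCoeff, ih, Nat.factorial_succ]
    push_cast
    field_simp
    ring

theorem hasSum_gaussCoeff (z : ℂ) :
    HasSum (fun n : ℕ => (gaussCoeff n : ℂ) * z ^ n) (Complex.exp (-z ^ 2)) := by
  rw [← add_zero (Complex.exp (-z ^ 2))]
  refine HasSum.even_add_odd ?_ ?_
  · rw [Complex.exp_eq_exp_ℂ]
    have h : (fun k : ℕ => (gaussCoeff (2 * k) : ℂ) * z ^ (2 * k)) =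
        fun k : ℕ => (-z ^ 2) ^ k / (k ! : ℂ) := by
      funext k
      rw [gaussCoeff_even, neg_pow (z ^ 2), ← pow_mul]
      push_cast
      ring
    rw [h]
    exact NormedSpace.expSeries_div_hasSum_exp (-z ^ 2)
  · simp [gaussCoeff_odd]

/-- The convolution of `e` with the Taylor coefficients of `exp (-z ^ 2)`. -/
def gaussConv (e : ℕ → ℝ) (n : ℕ) : ℝ :=
  ∑ p ∈ Finset.HasAntidiagonal.antidiagonal n, gaussCoeff p.1 * e p.2

theorem gaussConv_zero (e : ℕ → ℝ) : gaussConv e 0 = e 0 := by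
  simp [gaussConv, gaussCoeff]

/-- A Leibniz rule in terms of coefficients. With T zᵐ = θ(m) zᵐ⁻¹, it reads T(GE) = G'E + G·TE for
G = exp(-z²), valid because G is even. It is used for θ = `dunklFactor μ` and for the ordinary
derivative, θ(n) = n. -/
theorem sum_antidiagonal_succ_weight {θ : ℕ → ℝ} (h0 : θ 0 = 0)
    (hθ : ∀ j m, Even j → θ (j + m) = j + θ m) (e : ℕ → ℝ) (n : ℕ) :
    θ (n + 1) * gaussConv e (n + 1) =
      ∑ p ∈ Finset.HasAntidiagonal.antidiagonal n, ((p.1 + 1 : ℕ) : ℝ) * gaussCoeff (p.1 + 1) * e p.2 +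
      gaussConv (fun m => θ (m + 1) * e (m + 1)) n := by
  have h1 : θ (n + 1) * gaussConv e (n + 1) =
      ∑ p ∈ Finset.HasAntidiagonal.antidiagonal (n + 1), (p.1 : ℝ) * gaussCoeff p.1 * e p.2 +
      ∑ p ∈ Finset.HasAntidiagonal.antidiagonal (n + 1), gaussCoeff p.1 * (θ p.2 * e p.2) := by
    rw [gaussConv, Finset.mul_sum, ← Finset.sum_add_distrib]
    refine Finset.sum_congr rfl fun p hp => ?_
    rw [Finset.HasAntidiagonal.mem_antidiagonal] at hp
    rcases Nat.even_or_odd p.1 with h | ⟨k, hk⟩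
    · rw [← hp, hθ _ _ h]; ring
    · rw [hk, gaussCoeff_odd]; ring
  rw [h1, Finset.Nat.sum_antidiagonal_succ, Finset.Nat.sum_antidiagonal_succ' (n := n)]
  simp [h0, gaussConv]

theorem gaussConv_one {θ : ℕ → ℝ} (h0 : θ 0 = 0)
    (hθ : ∀ j m, Even j → θ (j + m) = j + θ m) (e : ℕ → ℝ) :
    θ 1 * gaussConv e 1 = θ 1 * e 1 := by
  have := sum_antidiagonal_succ_weight h0 hθ e 0
  simpa [gaussCoeff, gaussConv] using this

/-- The Leibniz rule combined with G' = -2zG. -/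
theorem gaussConv_succ_succ {θ : ℕ → ℝ} (h0 : θ 0 = 0)
    (hθ : ∀ j m, Even j → θ (j + m) = j + θ m) (e : ℕ → ℝ) (n : ℕ) :
    θ (n + 2) * gaussConv e (n + 2) =
      gaussConv (fun m => θ (m + 1) * e (m + 1)) (n + 1) - 2 * gaussConv e n := by
  rw [sum_antidiagonal_succ_weight h0 hθ e (n + 1), Finset.Nat.sum_antidiagonal_succ]
  have h2 : ∑ p ∈ Finset.HasAntidiagonal.antidiagonal n, ((p.1 + 1 + 1 : ℕ) : ℝ) * gaussCoeff (p.1 + 1 + 1) * e p.2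
      = -2 * gaussConv e n := by
    rw [gaussConv, Finset.mul_sum]
    refine Finset.sum_congr rfl fun p _ => ?_
    rw [gaussCoeff]
    push_cast
    field_simp
    ring
  rw [h2]
  simp only [zero_add, gaussCoeff]
  ring

/-- The sum `∑ (-1)^k / (k! j!)` over `2k + 2j = n` vanishes for `n ≠ 0`. -/
theorem gaussConv_even_inv_factorial (n : ℕ) :
    gaussConv (fun m => if Even m then 1 / ((m / 2)! : ℝ) else 0) (n + 1) = 0 := by
  set e : ℕ → ℝ := fun m => if Even m then 1 / ((m / 2)! : ℝ) else 0 with he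
  have h0 : (fun n : ℕ => (n : ℝ)) 0 = 0 := by simp
  have hθ : ∀ j m : ℕ, Even j → (fun n : ℕ => (n : ℝ)) (j + m) = j + (fun n : ℕ => (n : ℝ)) m := by
    intro j m _; push_cast; ring
  -- `e` lists the coefficients of exp(z²), so the claim is exp(-z²) exp(z²) = 1. The relation E' =
  -- 2zE makes the two terms on the right of `gaussConv_succ_succ` cancel.
  have h2 : ∀ m, ((m + 2 : ℕ) : ℝ) * e (m + 2) = 2 * e m := by
    intro m
    rcases Nat.even_or_odd' m with ⟨k, rfl | rfl⟩
    · have : (2 * k + 2) / 2 = k + 1 := by omega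
      have h3 : Even (2 * k + 2) := ⟨k + 1, by ring⟩
      have h5 : (2 * k) / 2 = k := by omega
      simp only [he, h3, even_two_mul, if_true, this, h5, Nat.factorial_succ]
      push_cast
      field_simp
    · have h3 : ¬ Even (2 * k + 1 + 2) := by
        rw [Nat.not_even_iff_odd]; exact ⟨k + 1, by ring⟩
      have h4 : ¬ Even (2 * k + 1) := by
        rw [Nat.not_even_iff_odd]; exact ⟨k, by ring⟩
      simp only [he, h3, h4, if_false, mul_zero]
  rcases n with _ | n
  · have := gaussConv_one (θ := fun n : ℕ => (n : ℝ)) h0 hθ e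
    simpa [he] using this
  · have h := gaussConv_succ_succ (θ := fun n : ℕ => (n : ℝ)) h0 hθ e n
    have h3 : gaussConv (fun m => ((m + 1 : ℕ) : ℝ) * e (m + 1)) (n + 1) = 2 * gaussConv e n := by
      have h6 : gaussConv (fun m => ((m + 1 : ℕ) : ℝ) * e (m + 1)) (n + 1) =
          gaussConv (fun m => ((m + 2 : ℕ) : ℝ) * e (m + 2)) n := by
        have he1 : e 1 = 0 := by simp [he]
        rw [gaussConv, Finset.Nat.sum_antidiagonal_succ', gaussConv, zero_add, he1, mul_zero,
          mul_zero, zero_add]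
      rw [h6]
      simp only [h2, gaussConv, Finset.mul_sum]
      exact Finset.sum_congr rfl fun p _ => by ring
    rw [h3, sub_self] at h
    exact (mul_eq_zero.1 h).resolve_left (by positivity)

/-- The generalized Hermite polynomial divided by `n!`. -/
def hermiteCoeff (μ : ℝ) (n : ℕ) (x : ℝ) : ℝ :=
  gaussConv (fun m => (2 * x) ^ m / genFactorial μ m) n

theorem genHermite_eq (μ : ℝ) (n : ℕ) (x : ℝ) :
    genHermite μ n x = (n ! : ℝ) * hermiteCoeff μ n x := by
  rw [genHermite, hermiteCoeff, gaussConv]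
  congr 1
  rw [Finset.Nat.sum_antidiagonal_eq_sum_range_succ_mk]
  symm
  -- The odd terms of the convolution vanish; on the others, halving the index matches the defining
  -- sum.
  refine Finset.sum_bij_ne_zero (fun k _ _ => k / 2) ?_ ?_ ?_ ?_
  · intro k hk _
    simp only [Finset.mem_range] at hk ⊢
    omega
  · intro a _ ha b _ hb hab
    have h : ∀ a, gaussCoeff a * ((2 * x) ^ (n - a) / genFactorial μ (n - a)) ≠ 0 → a = 2 * (a / 2) := by
      intro a ha
      rcases Nat.even_or_odd' a with ⟨k, rfl | rfl⟩
      · omega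
      · simp [gaussCoeff_odd] at ha
    rw [h a ha, h b hb, hab]
  · intro k hk h
    refine ⟨2 * k, ?_, ?_, ?_⟩
    · simp only [Finset.mem_range] at hk ⊢; omega
    · rw [gaussCoeff_even]
      contrapose! h
      rw [← h]
      ring
    · omega
  · intro a _ ha
    rcases Nat.even_or_odd' a with ⟨k, rfl | rfl⟩
    · rw [gaussCoeff_even]
      have : 2 * k / 2 = k := by omega
      rw [this]
      ring
    · simp [gaussCoeff_odd] at ha

/-! ### The three-term recurrence and the generating function -/

theorem hermiteCoeff_zero {μ : ℝ} (hμ : -(1 / 2) < μ) (x : ℝ) : hermiteCoeff μ 0 x = 1 := by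
  simp [hermiteCoeff, gaussConv_zero, genFactorial_zero hμ]

/-- The eigenvalue equation T e_μ(yz) = y e_μ(yz), coefficient by coefficient. -/
theorem dunklFactor_mul_pow_div {μ : ℝ} (hμ : -(1 / 2) < μ) (y : ℝ) (m : ℕ) :
    dunklFactor μ (m + 1) * (y ^ (m + 1) / genFactorial μ (m + 1)) =
      y * (y ^ m / genFactorial μ m) := by
  have h1 := (genFactorial_pos hμ m).ne'
  have h2 := (dunklFactor_succ_pos hμ m).ne'
  rw [genFactorial_succ hμ]
  field_simp
  ring

theorem hermiteCoeff_one {μ : ℝ} (hμ : -(1 / 2) < μ) (x : ℝ) :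
    dunklFactor μ 1 * hermiteCoeff μ 1 x = 2 * x * hermiteCoeff μ 0 x := by
  have h := gaussConv_one (dunklFactor_zero μ) (fun j m hj => dunklFactor_even_add μ hj m)
    (fun m => (2 * x) ^ m / genFactorial μ m)
  rw [hermiteCoeff, h, dunklFactor_mul_pow_div hμ (2 * x) 0, hermiteCoeff, gaussConv_zero]

/-- Applying T in the variable z to exp(-z²) e_μ(2xz) multiplies it by 2x - 2z; this compares
coefficients. -/
theorem hermiteCoeff_succ_succ {μ : ℝ} (hμ : -(1 / 2) < μ) (n : ℕ) (x : ℝ) :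
    dunklFactor μ (n + 2) * hermiteCoeff μ (n + 2) x =
      2 * x * hermiteCoeff μ (n + 1) x - 2 * hermiteCoeff μ n x := by
  have h := gaussConv_succ_succ (dunklFactor_zero μ) (fun j m hj => dunklFactor_even_add μ hj m)
    (fun m => (2 * x) ^ m / genFactorial μ m) n
  simp only [dunklFactor_mul_pow_div hμ] at h
  have h2 : gaussConv (fun m => 2 * x * ((2 * x) ^ m / genFactorial μ m)) (n + 1) =
      2 * x * hermiteCoeff μ (n + 1) x := by
    rw [hermiteCoeff, gaussConv, gaussConv, Finset.mul_sum]
    exact Finset.sum_congr rfl fun p _ => by ring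
  rw [hermiteCoeff, h, h2]
  rfl

theorem continuous_hermiteCoeff (μ : ℝ) (n : ℕ) : Continuous (hermiteCoeff μ n) := by
  unfold hermiteCoeff gaussConv
  fun_prop

theorem exists_abs_hermiteCoeff_le (μ : ℝ) (n : ℕ) :
    ∃ C : ℝ, 0 ≤ C ∧ ∀ x, |hermiteCoeff μ n x| ≤ C * Real.exp (2 * |x|) := by
  refine ⟨∑ p ∈ Finset.HasAntidiagonal.antidiagonal n, |gaussCoeff p.1| * (p.2 ! / |genFactorial μ p.2|),
    Finset.sum_nonneg fun p _ => by positivity, fun x => ?_⟩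
  rw [hermiteCoeff, gaussConv, Finset.sum_mul]
  refine (Finset.abs_sum_le_sum_abs _ _).trans (Finset.sum_le_sum fun p _ => ?_)
  have h : |2 * x| ^ p.2 ≤ p.2 ! * Real.exp (2 * |x|) := by
    have := Real.pow_div_factorial_le_exp (2 * |x|) (by positivity) p.2
    rw [div_le_iff₀ (by positivity)] at this
    rw [abs_mul, abs_two]
    linarith
  rw [abs_mul, abs_div, abs_pow]
  calc _ ≤ |gaussCoeff p.1| * (p.2 ! * Real.exp (2 * |x|) / |genFactorial μ p.2|) := by gcongr
    _ = _ := by ring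

/-- The generating function of the generalized Hermite polynomials. -/
theorem hasSum_hermiteCoeff {μ : ℝ} (hμ : -(1 / 2) < μ) (z : ℂ) (x : ℝ) :
    HasSum (fun n : ℕ => z ^ n * (hermiteCoeff μ n x : ℂ))
      (Complex.exp (-z ^ 2) * genExp μ (2 * x * z)) := by
  have h1 := hasSum_gaussCoeff z
  have h2 := hasSum_genExp hμ (2 * x * z)
  have h3 := summable_norm_sum_mul_antidiagonal_of_summable_norm h1.summable.norm
    h2.summable.norm
  have h4 := tsum_mul_tsum_eq_tsum_sum_antidiagonal_of_summable_norm h1.summable.norm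
    h2.summable.norm
  rw [h1.tsum_eq, h2.tsum_eq] at h4
  rw [h4]
  refine Eq.mp (congrArg (fun f => HasSum f _) (funext fun n => ?_)) h3.of_norm.hasSum
  symm
  rw [hermiteCoeff, gaussConv]
  push_cast
  rw [Finset.mul_sum]
  refine Finset.sum_congr rfl fun p hp => ?_
  rw [Finset.HasAntidiagonal.mem_antidiagonal] at hp
  rw [← hp, pow_add, mul_pow _ z]
  ring

/-! ### Integration against the weight -/

theorem weightMeasure_absolutelyContinuous_volume (μ : ℝ) : weightMeasure μ ≪ volume :=
  withDensity_absolutelyContinuous _ _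

section

variable {E : Type*} [NormedAddCommGroup E] [NormedSpace ℝ E]

theorem integrable_weightMeasure_iff (μ : ℝ) (f : ℝ → E) :
    Integrable f (weightMeasure μ) ↔ Integrable fun x : ℝ => |x| ^ (2 * μ) • f x := by
  rw [weightMeasure, integrable_withDensity_iff_integrable_smul' (by fun_prop)
    (Eventually.of_forall fun x => ENNReal.ofReal_lt_top)]
  have h : ∀ x : ℝ, (ENNReal.ofReal (|x| ^ (2 * μ))).toReal = |x| ^ (2 * μ) := fun x =>
    ENNReal.toReal_ofReal (by positivity)
  simp only [h]

theorem integral_weightMeasure (μ : ℝ) (f : ℝ → E) :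
    ∫ x, f x ∂(weightMeasure μ) = ∫ x : ℝ, |x| ^ (2 * μ) • f x := by
  rw [weightMeasure, integral_withDensity_eq_integral_toReal_smul (by fun_prop)
    (Eventually.of_forall fun x => ENNReal.ofReal_lt_top)]
  have h : ∀ x : ℝ, (ENNReal.ofReal (|x| ^ (2 * μ))).toReal = |x| ^ (2 * μ) := fun x =>
    ENNReal.toReal_ofReal (by positivity)
  simp only [h]

theorem integral_weightMeasure_comp_mul (μ : ℝ) (f : ℝ → E) {c : ℝ} (hc : 0 < c) :
    ∫ x, f (c * x) ∂(weightMeasure μ) = (c ^ (2 * μ + 1))⁻¹ • ∫ x, f x ∂(weightMeasure μ) := by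
  rw [integral_weightMeasure, integral_weightMeasure]
  have h := Measure.integral_comp_mul_left (fun y : ℝ => |y| ^ (2 * μ) • f y) c
  have h2 : (fun x : ℝ => |x| ^ (2 * μ) • f (c * x)) =
      fun x : ℝ => (c ^ (2 * μ))⁻¹ • (|c * x| ^ (2 * μ) • f (c * x)) := by
    funext x
    rw [abs_mul, abs_of_pos hc, Real.mul_rpow hc.le (abs_nonneg x), smul_smul, ← mul_assoc,
      inv_mul_cancel₀ (by positivity), one_mul]
  rw [h2, integral_smul, h, smul_smul, abs_of_pos (inv_pos.2 hc), Real.rpow_add hc, Real.rpow_one,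
    mul_inv]

theorem integral_weightMeasure_odd (μ : ℝ) {f : ℝ → E} (hf : ∀ x, f (-x) = -f x) :
    ∫ x, f x ∂(weightMeasure μ) = 0 := by
  rw [integral_weightMeasure]
  have h := integral_neg_eq_self (fun x : ℝ => |x| ^ (2 * μ) • f x) volume
  simp only [abs_neg, hf, smul_neg, integral_neg] at h
  have h2 : (2 : ℝ) • ∫ x : ℝ, |x| ^ (2 * μ) • f x = 0 := by
    rw [two_smul]
    nth_rewrite 1 [← h]
    exact neg_add_cancel _
  exact (smul_eq_zero.1 h2).resolve_left two_ne_zero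

end

theorem integrable_exp_neg_mul_sq_weight {μ : ℝ} (hμ : -(1 / 2) < μ) {s : ℝ} (hs : 0 < s) :
    Integrable (fun x : ℝ => Real.exp (-s * x ^ 2)) (weightMeasure μ) := by
  rw [integrable_weightMeasure_iff]
  have h := (integrable_rpow_mul_exp_neg_mul_sq hs (s := 2 * μ) (by linarith)).norm
  -- The real power of x and that of |x| agree for x > 0 only, so the negative half-line is obtained
  -- by reflection.
  have h1 : IntegrableOn (fun x : ℝ => |x| ^ (2 * μ) • Real.exp (-s * x ^ 2)) (Set.Ioi 0) := by
    refine h.integrableOn.congr_fun (fun x hx => ?_) measurableSet_Ioi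
    have hx : 0 < x := hx
    simp only [abs_of_pos hx, smul_eq_mul]
    rw [Real.norm_of_nonneg (by positivity)]
  rw [← integrableOn_univ, ← Set.Iic_union_Ioi (a := (0 : ℝ)), integrableOn_union]
  refine ⟨?_, h1⟩
  rw [← Measure.map_neg_eq_self (volume : Measure ℝ)]
  have m : MeasurableEmbedding fun x : ℝ => -x := (Homeomorph.neg ℝ).measurableEmbedding
  rw [m.integrableOn_map_iff]
  simp only [Function.comp_def, abs_neg, Set.neg_preimage, Set.neg_Iic, neg_zero, neg_sq]
  exact (integrableOn_Ici_iff_integrableOn_Ioi).2 h1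

theorem integrable_exp_abs_sub_sq_weight {μ : ℝ} (hμ : -(1 / 2) < μ) {s : ℝ} (hs : 0 < s) (c : ℝ) :
    Integrable (fun x : ℝ => Real.exp (c * |x| - s * x ^ 2)) (weightMeasure μ) := by
  -- Half of the Gaussian absorbs exp(c|x|): completing the square gives c|x| - s x²/2 ≤ c²/(2s).
  refine ((integrable_exp_neg_mul_sq_weight hμ (half_pos hs)).const_mul
    (Real.exp (c ^ 2 / (2 * s)))).mono' (by fun_prop) (Eventually.of_forall fun x => ?_)
  rw [Real.norm_of_nonneg (Real.exp_pos _).le, ← Real.exp_add, Real.exp_le_exp]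
  have h : c ^ 2 / (2 * s) + -(s / 2) * x ^ 2 - (c * |x| - s * x ^ 2) =
      (s * |x| - c) ^ 2 / (2 * s) := by
    rw [← sq_abs x]; field_simp; ring
  have : 0 ≤ (s * |x| - c) ^ 2 / (2 * s) := by positivity
  linarith

section

variable {E : Type*} [NormedAddCommGroup E]

theorem integrable_weight_of_norm_le {μ : ℝ} (hμ : -(1 / 2) < μ) {s : ℝ} (hs : 0 < s) {C c : ℝ}
    {f : ℝ → E} (hf : AEStronglyMeasurable f (weightMeasure μ))
    (h : ∀ x, ‖f x‖ ≤ C * Real.exp (c * |x| - s * x ^ 2)) : Integrable f (weightMeasure μ) :=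
  ((integrable_exp_abs_sub_sq_weight hμ hs c).const_mul C).mono' hf (Eventually.of_forall h)

theorem memLp_weight_of_norm_le {μ : ℝ} (hμ : -(1 / 2) < μ) {s : ℝ} (hs : 0 < s) {C c : ℝ}
    {f : ℝ → E} (hf : AEStronglyMeasurable f (weightMeasure μ))
    (h : ∀ x, ‖f x‖ ≤ C * Real.exp (c * |x| - s * x ^ 2)) : MemLp f 2 (weightMeasure μ) := by
  rw [memLp_two_iff_integrable_sq_norm hf]
  refine integrable_weight_of_norm_le hμ (s := 2 * s) (by positivity) (C := C ^ 2) (c := 2 * c)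
    (hf.norm.pow 2) fun x => ?_
  rw [Real.norm_of_nonneg (by positivity)]
  calc ‖f x‖ ^ 2 ≤ (C * Real.exp (c * |x| - s * x ^ 2)) ^ 2 := by gcongr; exact h x
    _ = _ := by rw [mul_pow, ← Real.exp_nat_mul]; congr 2; push_cast; ring

end

theorem integral_even_moment {μ : ℝ} (hμ : -(1 / 2) < μ) (k : ℕ) :
    ∫ x : ℝ, x ^ (2 * k) * Real.exp (-x ^ 2) ∂(weightMeasure μ) = Real.Gamma (k + μ + 1 / 2) := by
  rw [integral_weightMeasure]
  have h0 : (0 : ℝ) ≤ k := k.cast_nonneg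
  have h := integral_comp_abs (f := fun x : ℝ => x ^ (2 * μ) * (x ^ (2 * k) * Real.exp (-x ^ 2)))
  simp only [sq_abs, (even_two_mul k).pow_abs] at h
  simp only [smul_eq_mul]
  rw [h]
  have h2 := integral_rpow_mul_exp_neg_rpow (p := 2) (q := 2 * μ + 2 * k) (by norm_num)
    (by linarith)
  have h3 : ∫ x in Set.Ioi (0 : ℝ), x ^ (2 * μ) * (x ^ (2 * k) * Real.exp (-x ^ 2)) =
      ∫ x in Set.Ioi (0 : ℝ), x ^ (2 * μ + 2 * k) * Real.exp (-x ^ (2 : ℝ)) := by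
    refine setIntegral_congr_fun measurableSet_Ioi fun x hx => ?_
    have hx : 0 < x := hx
    rw [Real.rpow_add hx, Real.rpow_two, mul_assoc, ← Real.rpow_natCast x (2 * k)]
    push_cast
    rfl
  rw [h3, h2, show (2 * μ + 2 * k + 1) / 2 = k + μ + 1 / 2 by ring]
  ring

/-! ### Orthogonality of the Hermite functions -/

/-- The generalized Hermite functions normalized by the generating function
`∑ zⁿ ψ_n(x) = exp (-x² / 2 - z²) e_μ(2 x z)`. -/
def hermiteBase (μ : ℝ) (n : ℕ) (x : ℝ) : ℝ := Real.exp (-x ^ 2 / 2) * hermiteCoeff μ n x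

theorem continuous_hermiteBase (μ : ℝ) (n : ℕ) : Continuous (hermiteBase μ n) := by
  have := continuous_hermiteCoeff μ n
  unfold hermiteBase
  fun_prop

theorem exists_abs_hermiteBase_le (μ : ℝ) (n : ℕ) :
    ∃ C : ℝ, 0 ≤ C ∧ ∀ x, |hermiteBase μ n x| ≤ C * Real.exp (2 * |x| - 1 / 2 * x ^ 2) := by
  obtain ⟨C, hC, h⟩ := exists_abs_hermiteCoeff_le μ n
  refine ⟨C, hC, fun x => ?_⟩
  rw [hermiteBase, abs_mul, abs_of_pos (Real.exp_pos _)]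
  calc _ ≤ Real.exp (-x ^ 2 / 2) * (C * Real.exp (2 * |x|)) := by gcongr; exact h x
    _ = _ := by
      rw [mul_left_comm, ← Real.exp_add]; congr 2; ring

theorem hermiteBase_one {μ : ℝ} (hμ : -(1 / 2) < μ) (x : ℝ) :
    2 * x * hermiteBase μ 0 x = dunklFactor μ 1 * hermiteBase μ 1 x := by
  have := hermiteCoeff_one hμ x
  simp only [hermiteBase]
  linear_combination (-Real.exp (-x ^ 2 / 2)) * this

theorem hermiteBase_succ_succ {μ : ℝ} (hμ : -(1 / 2) < μ) (n : ℕ) (x : ℝ) :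
    2 * x * hermiteBase μ (n + 1) x =
      dunklFactor μ (n + 2) * hermiteBase μ (n + 2) x + 2 * hermiteBase μ n x := by
  have := hermiteCoeff_succ_succ hμ n x
  simp only [hermiteBase]
  linear_combination (-Real.exp (-x ^ 2 / 2)) * this

theorem integrable_hermiteBase_mul {μ : ℝ} (hμ : -(1 / 2) < μ) (m n : ℕ) :
    Integrable (fun x => hermiteBase μ m x * hermiteBase μ n x) (weightMeasure μ) := by
  obtain ⟨C, hC, h⟩ := exists_abs_hermiteBase_le μ m
  obtain ⟨C', hC', h'⟩ := exists_abs_hermiteBase_le μ n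
  refine integrable_weight_of_norm_le hμ one_pos (C := C * C') (c := 4)
    ((continuous_hermiteBase μ m).mul (continuous_hermiteBase μ n)).aestronglyMeasurable
    fun x => ?_
  rw [Real.norm_eq_abs, abs_mul]
  calc _ ≤ (C * Real.exp (2 * |x| - 1 / 2 * x ^ 2)) * (C' * Real.exp (2 * |x| - 1 / 2 * x ^ 2)) := by
        gcongr; exacts [h x, h' x]
    _ = _ := by rw [mul_mul_mul_comm, ← Real.exp_add]; congr 2; ring

/-- The Gram matrix of the functions `hermiteBase μ n`. -/
def hermiteGram (μ : ℝ) (m n : ℕ) : ℝ :=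
  ∫ x, hermiteBase μ m x * hermiteBase μ n x ∂(weightMeasure μ)

/-- The squared norm of `hermiteBase μ n`. -/
def hermiteNormSq (μ : ℝ) (n : ℕ) : ℝ := Real.Gamma (μ + 1 / 2) * (2 ^ n / genFactorial μ n)

theorem hermiteNormSq_pos {μ : ℝ} (hμ : -(1 / 2) < μ) (n : ℕ) : 0 < hermiteNormSq μ n := by
  have := Gamma_half_pos hμ
  have := genFactorial_pos hμ n
  unfold hermiteNormSq
  positivity

theorem dunklFactor_mul_hermiteNormSq {μ : ℝ} (hμ : -(1 / 2) < μ) (n : ℕ) :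
    dunklFactor μ (n + 1) * hermiteNormSq μ (n + 1) = 2 * hermiteNormSq μ n := by
  have h1 := (genFactorial_pos hμ n).ne'
  have h2 := (dunklFactor_succ_pos hμ n).ne'
  rw [hermiteNormSq, hermiteNormSq, genFactorial_succ hμ]
  field_simp
  ring

/-- The Gamma factor of γ(2k) cancels the Gaussian moment, which leaves the Taylor coefficients of
exp(z²). -/
theorem integral_pow_div_genFactorial {μ : ℝ} (hμ : -(1 / 2) < μ) (m : ℕ) :
    ∫ x : ℝ, (2 * x) ^ m / genFactorial μ m * Real.exp (-x ^ 2) ∂(weightMeasure μ) =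
      Real.Gamma (μ + 1 / 2) * (if Even m then 1 / ((m / 2)! : ℝ) else 0) := by
  rcases Nat.even_or_odd' m with ⟨k, rfl | rfl⟩
  · have h1 : (fun x : ℝ => (2 * x) ^ (2 * k) / genFactorial μ (2 * k) * Real.exp (-x ^ 2)) =
        fun x : ℝ => (2 ^ (2 * k) / genFactorial μ (2 * k)) * (x ^ (2 * k) * Real.exp (-x ^ 2)) := by
      funext x; rw [mul_pow]; ring
    have e1 : (2 * k) / 2 = k := by omega
    have e2 : (2 * k + 1) / 2 = k := by omega
    have h2 : Real.Gamma (k + μ + 1 / 2) ≠ 0 := by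
      have : (0 : ℝ) ≤ k := k.cast_nonneg
      exact (Real.Gamma_pos_of_pos (by linarith)).ne'
    have h3 := (Gamma_half_pos hμ).ne'
    have h4 : ((k ! : ℕ) : ℝ) ≠ 0 := by positivity
    rw [h1, integral_const_mul, integral_even_moment hμ]
    simp only [even_two_mul, if_true, genFactorial, e1, e2]
    generalize Real.Gamma (k + μ + 1 / 2) = A at *
    generalize Real.Gamma (μ + 1 / 2) = B at *
    field_simp
  · have : ¬ Even (2 * k + 1) := by rw [Nat.not_even_iff_odd]; exact ⟨k, rfl⟩
    rw [if_neg this, mul_zero]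
    refine integral_weightMeasure_odd μ fun x => ?_
    have h : (2 * -x) ^ (2 * k + 1) = -(2 * x) ^ (2 * k + 1) := by
      rw [← Odd.neg_pow ⟨k, rfl⟩]; congr 1; ring
    rw [h, neg_sq]
    ring

/-- Integrating ψ_0 against the generating function replaces e_μ(2xz) by Γ(μ+1/2) exp(z²), which the
factor exp(-z²) cancels; only the term n = 0 survives. -/
theorem hermiteGram_zero_left {μ : ℝ} (hμ : -(1 / 2) < μ) (n : ℕ) :
    hermiteGram μ 0 n = if 0 = n then hermiteNormSq μ n else 0 := by
  have h1 : hermiteGram μ 0 n = Real.Gamma (μ + 1 / 2) *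
      gaussConv (fun m => if Even m then 1 / ((m / 2)! : ℝ) else 0) n := by
    have h2 : ∀ x, hermiteBase μ 0 x * hermiteBase μ n x =
        ∑ p ∈ Finset.HasAntidiagonal.antidiagonal n, gaussCoeff p.1 *
          ((2 * x) ^ p.2 / genFactorial μ p.2 * Real.exp (-x ^ 2)) := by
      intro x
      have : Real.exp (-x ^ 2) = Real.exp (-x ^ 2 / 2) * Real.exp (-x ^ 2 / 2) := by
        rw [← Real.exp_add]; congr 1; ring
      rw [hermiteBase, hermiteBase, hermiteCoeff_zero hμ, hermiteCoeff, gaussConv, this,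
        Finset.mul_sum, Finset.mul_sum]
      exact Finset.sum_congr rfl fun p _ => by ring
    simp only [hermiteGram, h2]
    rw [integral_finsetSum]
    · simp only [integral_const_mul, integral_pow_div_genFactorial hμ, gaussConv]
      rw [Finset.mul_sum]
      exact Finset.sum_congr rfl fun p _ => by ring
    · intro p _
      refine Integrable.const_mul ?_ _
      refine integrable_weight_of_norm_le hμ one_pos (C := p.2 ! / |genFactorial μ p.2|) (c := 2)
        (by fun_prop) fun x => ?_
      have h := Real.pow_div_factorial_le_exp (2 * |x|) (by positivity) p.2
      rw [div_le_iff₀ (by positivity)] at h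
      rw [norm_mul, norm_div, norm_pow, Real.norm_eq_abs, Real.norm_eq_abs,
        Real.norm_of_nonneg (Real.exp_pos _).le, abs_mul, abs_two, sub_eq_add_neg, Real.exp_add]
      calc _ ≤ (Real.exp (2 * |x|) * p.2 !) / |genFactorial μ p.2| * Real.exp (-x ^ 2) := by gcongr
        _ = _ := by rw [one_mul]; ring
  rw [h1]
  rcases n with _ | n
  · simp [gaussConv_zero, hermiteNormSq, genFactorial_zero hμ]
  · rw [gaussConv_even_inv_factorial, mul_zero, if_neg (by omega)]

theorem hermiteGram_one_left {μ : ℝ} (hμ : -(1 / 2) < μ) (n : ℕ) :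
    dunklFactor μ 1 * hermiteGram μ 1 n = dunklFactor μ (n + 1) * hermiteGram μ 0 (n + 1) +
      (if n = 0 then 0 else 2 * hermiteGram μ 0 (n - 1)) := by
  have hi := integrable_hermiteBase_mul hμ
  simp only [hermiteGram]
  rcases n with _ | n
  · rw [if_pos rfl, add_zero, zero_add, ← integral_const_mul, ← integral_const_mul]
    congr 1; funext x
    ring
  · rw [if_neg (by omega), Nat.add_sub_cancel, ← integral_const_mul, ← integral_const_mul,
      ← integral_const_mul, ← integral_add ((hi _ _).const_mul _) ((hi _ _).const_mul _)]
    congr 1; funext x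
    linear_combination (hermiteBase μ 0 x) * (hermiteBase_succ_succ hμ n x) -
      (hermiteBase μ (n + 1) x) * (hermiteBase_one hμ x)

/-- Multiplication by 2x is symmetric: expand 2x ψ_{m+1} ψ_n by the recurrence at either factor. The
conditional drops the absent ψ_{-1} at n = 0. -/
theorem hermiteGram_succ_succ_left {μ : ℝ} (hμ : -(1 / 2) < μ) (m n : ℕ) :
    dunklFactor μ (m + 2) * hermiteGram μ (m + 2) n =
      dunklFactor μ (n + 1) * hermiteGram μ (m + 1) (n + 1) +
      (if n = 0 then 0 else 2 * hermiteGram μ (m + 1) (n - 1)) - 2 * hermiteGram μ m n := by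
  have hi := integrable_hermiteBase_mul hμ
  simp only [hermiteGram]
  rcases n with _ | n
  · rw [if_pos rfl, add_zero, zero_add, ← integral_const_mul, ← integral_const_mul,
      ← integral_const_mul, ← integral_sub ((hi _ _).const_mul _) ((hi _ _).const_mul _)]
    congr 1; funext x
    linear_combination (hermiteBase μ (m + 1) x) * (hermiteBase_one hμ x) -
      (hermiteBase μ 0 x) * (hermiteBase_succ_succ hμ m x)
  · rw [if_neg (by omega), Nat.add_sub_cancel, ← integral_const_mul, ← integral_const_mul,
      ← integral_const_mul, ← integral_const_mul,
      ← integral_add ((hi _ _).const_mul _) ((hi _ _).const_mul _),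
      ← integral_sub (f := fun x => dunklFactor μ (n + 1 + 1) *
        (hermiteBase μ (m + 1) x * hermiteBase μ (n + 1 + 1) x) +
        2 * (hermiteBase μ (m + 1) x * hermiteBase μ n x))
        (((hi _ _).const_mul _).add ((hi _ _).const_mul _)) ((hi _ _).const_mul _)]
    congr 1; funext x
    linear_combination (hermiteBase μ (m + 1) x) * (hermiteBase_succ_succ hμ n x) -
      (hermiteBase μ (n + 1) x) * (hermiteBase_succ_succ hμ m x)

/-- The recurrence determines all rows of the Gram matrix from row 0. Off the cases n = m and n = m
+ 2 every term vanishes; those two come down to θ(n+1)‖ψ_{n+1}‖² = 2‖ψ_n‖². -/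
theorem hermiteGram_eq {μ : ℝ} (hμ : -(1 / 2) < μ) (m n : ℕ) :
    hermiteGram μ m n = if m = n then hermiteNormSq μ n else 0 := by
  induction m using Nat.twoStepInduction generalizing n with
  | zero => exact hermiteGram_zero_left hμ n
  | one =>
    have hθ := (dunklFactor_succ_pos hμ 0).ne'
    refine mul_left_cancel₀ hθ ?_
    rw [zero_add, hermiteGram_one_left hμ]
    simp only [hermiteGram_zero_left hμ]
    rcases n with _ | _ | n
    · simp
    · simpa using (dunklFactor_mul_hermiteNormSq hμ 0).symm
    · simp
  | more m ih1 ih2 =>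
    have hθ := (dunklFactor_succ_pos hμ (m + 1)).ne'
    refine mul_left_cancel₀ hθ ?_
    rw [hermiteGram_succ_succ_left hμ]
    simp only [ih1, ih2]
    have h1 := dunklFactor_mul_hermiteNormSq hμ m
    have h2 := dunklFactor_mul_hermiteNormSq hμ (m + 1)
    by_cases hn : n = m
    · subst hn
      have e1 : ¬ (n + 1 = n - 1) := by omega
      simp [e1, h1]
    · by_cases hn2 : n = m + 2
      · subst hn2
        have e1 : m + 2 - 1 = m + 1 := by omega
        simp [e1, h2]
      · have e1 : ¬ (m + 1 = n + 1) := by omega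
        have e2 : ¬ (m + 2 = n) := by omega
        have e3 : ¬ m = n := by omega
        rw [if_neg e1, if_neg e2, if_neg e3]
        split_ifs with h4 h5
        · ring
        · omega
        · ring

/-! ### Determinacy of the moment problem under exponential integrability -/

/-- Expand exp(itx) in its power series; exponential integrability provides the majorant |h|
exp(|t||x|) needed to integrate termwise. -/
theorem integral_mul_cexp_eq_zero {ν : Measure ℝ} {h : ℝ → ℝ}
    (hint : ∀ c : ℝ, Integrable (fun x => h x * Real.exp (c * |x|)) ν)
    (hmom : ∀ n : ℕ, ∫ x, h x * x ^ n ∂ν = 0) (t : ℝ) :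
    ∫ x, (h x : ℂ) * Complex.exp ((t * x : ℝ) * Complex.I) ∂ν = 0 := by
  have h0 : Integrable h ν := by simpa using hint 0
  have hs : ∀ x : ℝ, HasSum (fun n : ℕ => |h x| * (|t * x| ^ n / (n ! : ℝ)))
      (|h x| * Real.exp (|t| * |x|)) := by
    intro x
    rw [Real.exp_eq_exp_ℝ, ← abs_mul]
    exact (NormedSpace.expSeries_div_hasSum_exp |t * x|).mul_left _
  have key := hasSum_integral_of_dominated_convergence (μ := ν)
    (F := fun (n : ℕ) (x : ℝ) => (h x : ℂ) * (((t * x : ℝ) * Complex.I) ^ n / (n ! : ℂ)))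
    (f := fun x => (h x : ℂ) * Complex.exp ((t * x : ℝ) * Complex.I))
    (fun n x => |h x| * (|t * x| ^ n / (n ! : ℝ))) ?_ ?_ ?_ ?_ ?_
  · refine key.unique ?_
    have h1 : ∀ n : ℕ, ∫ x, (h x : ℂ) * (((t * x : ℝ) * Complex.I) ^ n / (n ! : ℂ)) ∂ν = 0 := by
      intro n
      have h2 : (fun x : ℝ => (h x : ℂ) * (((t * x : ℝ) * Complex.I) ^ n / (n ! : ℂ))) =
          fun x : ℝ => ((t * Complex.I) ^ n / (n ! : ℂ)) * ((h x * x ^ n : ℝ) : ℂ) := by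
        funext x
        push_cast
        rw [mul_right_comm, mul_pow _ (x : ℂ)]
        ring
      rw [h2, integral_const_mul, integral_complex_ofReal, hmom]
      simp
    simp only [h1]
    exact hasSum_zero
  · intro n
    exact (Complex.continuous_ofReal.comp_aestronglyMeasurable h0.aestronglyMeasurable).mul
      (by fun_prop)
  · intro n
    refine Eventually.of_forall fun x => ?_
    simp [abs_mul]
  · exact Eventually.of_forall fun x => (hs x).summable
  · refine (hint |t|).norm.congr (Eventually.of_forall fun x => ?_)
    simp only [(hs x).tsum_eq, norm_mul, Real.norm_eq_abs, Real.abs_exp]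
  · refine Eventually.of_forall fun x => ?_
    have h1 := NormedSpace.expSeries_div_hasSum_exp (((t * x : ℝ) : ℂ) * Complex.I)
    rw [← Complex.exp_eq_exp_ℂ] at h1
    exact h1.mul_left _

/-- The positive and negative parts of h are densities of finite measures with equal characteristic
functions, so these measures coincide, and with them the densities. -/
theorem ae_eq_zero_of_integral_mul_cexp_eq_zero {ν : Measure ℝ} {h : ℝ → ℝ} (hint : Integrable h ν)
    (hF : ∀ t : ℝ, ∫ x, (h x : ℂ) * Complex.exp ((t * x : ℝ) * Complex.I) ∂ν = 0) :
    h =ᵐ[ν] 0 := by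
  have hm : ∀ {g : ℝ → ℝ}, Integrable g ν → AEMeasurable (fun x => ENNReal.ofReal (g x)) ν :=
    fun hg => hg.aestronglyMeasurable.aemeasurable.ennreal_ofReal
  have hfin : ∀ {g : ℝ → ℝ}, Integrable g ν → ∫⁻ x, ENNReal.ofReal (g x) ∂ν ≠ ∞ := fun hg =>
    hg.lintegral_lt_top.ne
  have : IsFiniteMeasure (ν.withDensity fun x => ENNReal.ofReal (h x)) :=
    isFiniteMeasure_withDensity (hfin hint)
  have : IsFiniteMeasure (ν.withDensity fun x => ENNReal.ofReal (-h x)) :=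
    isFiniteMeasure_withDensity (hfin hint.neg)
  have hc : ∀ {g : ℝ → ℝ}, Integrable g ν → ∀ t,
      charFun (ν.withDensity fun x => ENNReal.ofReal (g x)) t =
        ∫ x, ((max (g x) 0 : ℝ) : ℂ) * Complex.exp ((t * x : ℝ) * Complex.I) ∂ν := by
    intro g hg t
    rw [charFun_apply, integral_withDensity_eq_integral_toReal_smul₀ (hm hg)
      (Eventually.of_forall fun _ => ENNReal.ofReal_lt_top)]
    refine integral_congr_ae (Eventually.of_forall fun x => ?_)
    simp only [ENNReal.toReal_ofReal', Complex.real_smul]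
    congr 3
  have hi : ∀ {g : ℝ → ℝ}, Integrable g ν → ∀ t : ℝ,
      Integrable (fun x => ((max (g x) 0 : ℝ) : ℂ) * Complex.exp ((t * x : ℝ) * Complex.I)) ν := by
    intro g hg t
    refine (hg.pos_part.ofReal (𝕜 := ℂ)).mul_bdd (c := 1) (by fun_prop)
      (Eventually.of_forall fun x => ?_)
    rw [Complex.norm_exp_ofReal_mul_I]
  have heq : (ν.withDensity fun x => ENNReal.ofReal (h x)) =
      ν.withDensity fun x => ENNReal.ofReal (-h x) := by
    refine Measure.ext_of_charFun (funext fun t => ?_)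
    rw [hc hint, hc (g := fun x => -h x) hint.neg, ← sub_eq_zero, ← integral_sub (hi hint t) (hi (g := fun x => -h x) hint.neg t), ← hF t]
    refine integral_congr_ae (Eventually.of_forall fun x => ?_)
    simp only [← sub_mul, ← Complex.ofReal_sub]
    congr 2
    exact max_zero_sub_max_neg_zero_eq_self (h x)
  have h1 := (withDensity_eq_iff (hm hint) (hm hint.neg) (hfin hint)).1 heq
  filter_upwards [h1] with x hx
  simp only [Pi.zero_apply, Pi.neg_apply] at hx ⊢
  rcases le_total (h x) 0 with h2 | h2
  · rw [ENNReal.ofReal_of_nonpos h2] at hx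
    have := ENNReal.ofReal_eq_zero.1 hx.symm
    linarith
  · rw [ENNReal.ofReal_of_nonpos (neg_nonpos.2 h2)] at hx
    have := ENNReal.ofReal_eq_zero.1 hx
    linarith

/-- A complex density with exponential moments is determined by its moments. -/
theorem ae_eq_zero_of_moments_eq_zero {ν : Measure ℝ} {h : ℝ → ℂ}
    (hint : ∀ c : ℝ, Integrable (fun x => h x * (Real.exp (c * |x|) : ℂ)) ν)
    (hmom : ∀ n : ℕ, ∫ x, h x * (x : ℂ) ^ n ∂ν = 0) : h =ᵐ[ν] 0 := by
  have hi : ∀ n : ℕ, Integrable (fun x => h x * (x : ℂ) ^ n) ν := by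
    intro n
    refine ((hint 1).norm.const_mul (n ! : ℝ)).mono' ?_ (Eventually.of_forall fun x => ?_)
    · have h0 : Integrable h ν := by simpa using hint 0
      exact h0.aestronglyMeasurable.mul (by fun_prop)
    · have h2 := Real.pow_div_factorial_le_exp |x| (by positivity) n
      rw [div_le_iff₀ (by positivity)] at h2
      simp only [norm_mul, norm_pow, Complex.norm_real, Real.norm_eq_abs, Real.abs_exp, one_mul]
      calc _ ≤ ‖h x‖ * (Real.exp |x| * n !) := by gcongr
        _ = _ := by ring
  have hre : (fun x => (h x).re) =ᵐ[ν] 0 := by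
    have hint' : ∀ c : ℝ, Integrable (fun x => (h x).re * Real.exp (c * |x|)) ν := by
      intro c
      refine (hint c).re.congr (Eventually.of_forall fun x => ?_)
      simp only [RCLike.re_to_complex, Complex.re_mul_ofReal]
    refine ae_eq_zero_of_integral_mul_cexp_eq_zero (by simpa using hint' 0)
      (integral_mul_cexp_eq_zero hint' fun n => ?_)
    have h1 := integral_re (hi n)
    rw [hmom] at h1
    rw [← Complex.zero_re, ← RCLike.re_to_complex, ← h1]
    refine integral_congr_ae (Eventually.of_forall fun x => ?_)
    simp only [RCLike.re_to_complex, ← Complex.ofReal_pow, Complex.re_mul_ofReal]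
  have him : (fun x => (h x).im) =ᵐ[ν] 0 := by
    have hint' : ∀ c : ℝ, Integrable (fun x => (h x).im * Real.exp (c * |x|)) ν := by
      intro c
      refine (hint c).im.congr (Eventually.of_forall fun x => ?_)
      simp only [RCLike.im_to_complex, Complex.im_mul_ofReal]
    refine ae_eq_zero_of_integral_mul_cexp_eq_zero (by simpa using hint' 0)
      (integral_mul_cexp_eq_zero hint' fun n => ?_)
    have h1 := integral_im (hi n)
    rw [hmom] at h1
    rw [← Complex.zero_im, ← RCLike.im_to_complex, ← h1]
    refine integral_congr_ae (Eventually.of_forall fun x => ?_)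
    simp only [RCLike.im_to_complex, ← Complex.ofReal_pow, Complex.im_mul_ofReal]
  filter_upwards [hre, him] with x h1 h2
  exact Complex.ext h1 h2

/-! ### Completeness of the Hermite functions -/

theorem exists_pow_mul_hermiteBase_le (μ : ℝ) (N n : ℕ) :
    ∃ C : ℝ, 0 ≤ C ∧ ∀ x : ℝ, |x ^ N * hermiteBase μ n x| ≤
      C * Real.exp (3 * |x| - 1 / 2 * x ^ 2) := by
  obtain ⟨C, hC, h⟩ := exists_abs_hermiteBase_le μ n
  refine ⟨N ! * C, by positivity, fun x => ?_⟩
  have h2 := Real.pow_div_factorial_le_exp |x| (by positivity) N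
  rw [div_le_iff₀ (by positivity)] at h2
  rw [abs_mul, abs_pow]
  calc _ ≤ (Real.exp |x| * N !) * (C * Real.exp (2 * |x| - 1 / 2 * x ^ 2)) := by
        gcongr; exact h x
    _ = N ! * C * (Real.exp |x| * Real.exp (2 * |x| - 1 / 2 * x ^ 2)) := by ring
    _ = _ := by rw [← Real.exp_add]; congr 2; ring

/-- Each factor x is traded for neighbouring indices by the three-term recurrence, which is why the
induction on N runs over all n at once. The case n = 0 says that all moments of h(x) exp(-x²/2)
vanish. -/
theorem integral_mul_pow_mul_hermiteBase {μ : ℝ} (hμ : -(1 / 2) < μ) {h : ℝ → ℂ}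
    (hint : ∀ c : ℝ, Integrable (fun x => h x * (Real.exp (c * |x| - 1 / 2 * x ^ 2) : ℂ))
      (weightMeasure μ))
    (horth : ∀ n : ℕ, ∫ x, h x * (hermiteBase μ n x : ℂ) ∂(weightMeasure μ) = 0) (N : ℕ) :
    ∀ n : ℕ, ∫ x : ℝ, h x * ((x ^ N * hermiteBase μ n x : ℝ) : ℂ) ∂(weightMeasure μ) = 0 := by
  -- Measurability of h is recovered from `hint 0` by multiplying the Gaussian away.
  have hmeas : AEStronglyMeasurable h (weightMeasure μ) := by
    have := (hint 0).aestronglyMeasurable.mul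
      (g := fun x : ℝ => (Real.exp (1 / 2 * x ^ 2) : ℂ)) (by fun_prop)
    refine this.congr (Eventually.of_forall fun x => ?_)
    simp only [Pi.mul_apply, mul_assoc, ← Complex.ofReal_mul, ← Real.exp_add]
    simp
  have hi : ∀ N n : ℕ, Integrable (fun x : ℝ => h x * ((x ^ N * hermiteBase μ n x : ℝ) : ℂ))
      (weightMeasure μ) := by
    intro N n
    obtain ⟨C, hC, hb⟩ := exists_pow_mul_hermiteBase_le μ N n
    refine ((hint 3).norm.const_mul C).mono' ?_ (Eventually.of_forall fun x => ?_)
    · have := continuous_hermiteBase μ n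
      exact hmeas.mul (by fun_prop)
    · rw [norm_mul, Complex.norm_real, norm_mul (h x), Complex.norm_real, Real.norm_eq_abs,
        Real.norm_of_nonneg (Real.exp_pos _).le]
      calc _ ≤ ‖h x‖ * (C * Real.exp (3 * |x| - 1 / 2 * x ^ 2)) := by gcongr; exact hb x
        _ = _ := by ring
  induction N with
  | zero => intro n; simpa using horth n
  | succ N ih =>
    intro n
    rcases n with _ | n
    · have h1 : (fun x : ℝ => h x * ((x ^ (N + 1) * hermiteBase μ 0 x : ℝ) : ℂ)) =
          fun x : ℝ => ((dunklFactor μ 1 / 2 : ℝ) : ℂ) *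
            (h x * ((x ^ N * hermiteBase μ 1 x : ℝ) : ℂ)) := by
        funext x
        have := hermiteBase_one hμ x
        rw [show x ^ (N + 1) * hermiteBase μ 0 x =
          (dunklFactor μ 1 / 2) * (x ^ N * hermiteBase μ 1 x) by
            linear_combination (x ^ N / 2) * this]
        push_cast
        ring
      rw [h1, integral_const_mul, ih, mul_zero]
    · have h1 : (fun x : ℝ => h x * ((x ^ (N + 1) * hermiteBase μ (n + 1) x : ℝ) : ℂ)) =
          fun x : ℝ => ((dunklFactor μ (n + 2) / 2 : ℝ) : ℂ) *
            (h x * ((x ^ N * hermiteBase μ (n + 2) x : ℝ) : ℂ)) +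
            h x * ((x ^ N * hermiteBase μ n x : ℝ) : ℂ) := by
        funext x
        have := hermiteBase_succ_succ hμ n x
        rw [show x ^ (N + 1) * hermiteBase μ (n + 1) x =
          (dunklFactor μ (n + 2) / 2) * (x ^ N * hermiteBase μ (n + 2) x) +
            x ^ N * hermiteBase μ n x by linear_combination (x ^ N / 2) * this]
        push_cast
        ring
      rw [h1, integral_add ((hi _ _).const_mul _) (hi _ _), integral_const_mul, ih, ih, mul_zero,
        add_zero]

/-- Only integrability against Gaussians is required, not h ∈ L²: the density of the range of P + i
needs the case h = (x - i)F with F ∈ L², which may fail to be square integrable. -/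
theorem ae_eq_zero_of_hermiteBase_orthogonal {μ : ℝ} (hμ : -(1 / 2) < μ) {h : ℝ → ℂ}
    (hint : ∀ c : ℝ, Integrable (fun x => h x * (Real.exp (c * |x| - 1 / 2 * x ^ 2) : ℂ))
      (weightMeasure μ))
    (horth : ∀ n : ℕ, ∫ x, h x * (hermiteBase μ n x : ℂ) ∂(weightMeasure μ) = 0) :
    h =ᵐ[weightMeasure μ] 0 := by
  have h1 := ae_eq_zero_of_moments_eq_zero (ν := weightMeasure μ)
    (h := fun x => h x * (Real.exp (-x ^ 2 / 2) : ℂ)) ?_ ?_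
  · filter_upwards [h1] with x hx
    simpa using hx
  · intro c
    refine (hint c).congr (Eventually.of_forall fun x => ?_)
    simp only [mul_assoc, ← Complex.ofReal_mul, ← Real.exp_add]
    congr 3
    ring
  · intro N
    rw [← integral_mul_pow_mul_hermiteBase hμ hint horth N 0]
    refine integral_congr_ae (Eventually.of_forall fun x => ?_)
    simp only [hermiteBase, hermiteCoeff_zero hμ]
    push_cast
    ring

theorem integrable_mul_exp_of_memLp {μ : ℝ} (hμ : -(1 / 2) < μ) {h : ℝ → ℂ}
    (hh : MemLp h 2 (weightMeasure μ)) (c : ℝ) :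
    Integrable (fun x => h x * (Real.exp (c * |x| - 1 / 2 * x ^ 2) : ℂ)) (weightMeasure μ) := by
  refine hh.integrable_mul (memLp_weight_of_norm_le hμ one_half_pos (C := 1) (c := c)
    (by fun_prop) fun x => ?_)
  rw [Complex.norm_real, Real.norm_of_nonneg (Real.exp_pos _).le, one_mul]

theorem integrable_ofReal_mul_exp_of_memLp {μ : ℝ} (hμ : -(1 / 2) < μ) {h : ℝ → ℂ}
    (hh : MemLp h 2 (weightMeasure μ)) (c : ℝ) :
    Integrable (fun x : ℝ => (x : ℂ) * h x * (Real.exp (c * |x| - 1 / 2 * x ^ 2) : ℂ))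
      (weightMeasure μ) := by
  refine (integrable_mul_exp_of_memLp hμ hh (c + 1)).norm.mono' ?_ (Eventually.of_forall fun x => ?_)
  · have := hh.aestronglyMeasurable
    exact (AEStronglyMeasurable.mul (by fun_prop) this).mul (by fun_prop)
  · rw [norm_mul, norm_mul, norm_mul, Complex.norm_real, Complex.norm_real, Complex.norm_real,
      Real.norm_eq_abs, Real.norm_of_nonneg (Real.exp_pos _).le,
      Real.norm_of_nonneg (Real.exp_pos _).le, show (c + 1) * |x| - 1 / 2 * x ^ 2 =
      |x| + (c * |x| - 1 / 2 * x ^ 2) by ring, Real.exp_add]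
    have : |x| ≤ Real.exp |x| := by linarith [Real.add_one_le_exp |x|]
    calc _ ≤ Real.exp |x| * ‖h x‖ * Real.exp (c * |x| - 1 / 2 * x ^ 2) := by gcongr
      _ = _ := by ring

end BoseLike

/-! ### Multiplication operators on `L²` -/

section Multiplication

variable {ν : Measure ℝ}

theorem memLp_ofReal_mul {m : ℝ → ℝ} (hm : Measurable m) {C : ℝ} (hC : ∀ x, |m x| ≤ C)
    (f : Lp ℂ 2 ν) : MemLp (fun x => (m x : ℂ) * f x) 2 ν := by
  refine (Lp.memLp f).of_le_mul (c := C) ?_ (Eventually.of_forall fun x => ?_)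
  · exact AEStronglyMeasurable.mul (by fun_prop) (Lp.aestronglyMeasurable f)
  · rw [norm_mul, Complex.norm_real, Real.norm_eq_abs]
    gcongr
    exact hC x

variable (ν) in
open scoped Classical in
/-- The operator of multiplication by the bounded measurable function `m` (zero if `m` is not
bounded and measurable). -/
def mulOp (m : ℝ → ℝ) : Lp ℂ 2 ν →L[ℂ] Lp ℂ 2 ν :=
  if h : Measurable m ∧ ∃ C, ∀ x, |m x| ≤ C then
    LinearMap.mkContinuous
      { toFun := fun f => (memLp_ofReal_mul h.1 h.2.choose_spec f).toLp _
        map_add' := fun f g => by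
          rw [← MemLp.toLp_add]
          refine MemLp.toLp_congr _ _ ?_
          filter_upwards [Lp.coeFn_add f g] with x hx
          simp only [hx, Pi.add_apply, mul_add]
        map_smul' := fun c f => by
          rw [RingHom.id_apply, ← MemLp.toLp_const_smul]
          refine MemLp.toLp_congr _ _ ?_
          filter_upwards [Lp.coeFn_smul c f] with x hx
          simp only [hx, Pi.smul_apply, smul_eq_mul]
          ring } h.2.choose (fun f => by
      refine Lp.norm_le_mul_norm_of_ae_le_mul ?_
      simp only [LinearMap.coe_mk, AddHom.coe_mk]
      filter_upwards [MemLp.coeFn_toLp (memLp_ofReal_mul h.1 h.2.choose_spec f)] with x hx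
      rw [hx, norm_mul, Complex.norm_real, Real.norm_eq_abs]
      gcongr
      exact h.2.choose_spec x)
  else 0

theorem coeFn_mulOp {m : ℝ → ℝ} (hm : Measurable m) {C : ℝ} (hC : ∀ x, |m x| ≤ C)
    (f : Lp ℂ 2 ν) : mulOp ν m f =ᵐ[ν] fun x => (m x : ℂ) * f x := by
  have h : Measurable m ∧ ∃ C, ∀ x, |m x| ≤ C := ⟨hm, C, hC⟩
  rw [mulOp, dif_pos h]
  exact MemLp.coeFn_toLp (memLp_ofReal_mul h.1 h.2.choose_spec f)

theorem mulOp_mulOp {m k : ℝ → ℝ} (hm : Measurable m) {C : ℝ} (hC : ∀ x, |m x| ≤ C)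
    (hk : Measurable k) {D : ℝ} (hD : ∀ x, |k x| ≤ D) (f : Lp ℂ 2 ν) :
    mulOp ν m (mulOp ν k f) = mulOp ν (fun x => m x * k x) f := by
  refine Lp.ext ?_
  have h : ∀ x, |m x * k x| ≤ C * D := fun x => by
    rw [abs_mul]
    exact mul_le_mul (hC x) (hD x) (abs_nonneg _) ((abs_nonneg _).trans (hC x))
  filter_upwards [coeFn_mulOp hm hC (mulOp ν k f), coeFn_mulOp hk hD f,
    coeFn_mulOp (hm.mul hk) h f] with x h1 h2 h3
  rw [h1, h2]
  refine Eq.trans ?_ h3.symm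
  push_cast [Pi.mul_apply]
  ring

theorem mulOp_one (f : Lp ℂ 2 ν) : mulOp ν (fun _ => 1) f = f := by
  refine Lp.ext ?_
  filter_upwards [coeFn_mulOp (measurable_const (a := (1 : ℝ))) (C := 1) (by simp) f] with x h1
  rw [h1]
  simp

theorem mulOp_sub {m k : ℝ → ℝ} (hm : Measurable m) {C : ℝ} (hC : ∀ x, |m x| ≤ C)
    (hk : Measurable k) {D : ℝ} (hD : ∀ x, |k x| ≤ D) (f : Lp ℂ 2 ν) :
    mulOp ν m f - mulOp ν k f = mulOp ν (fun x => m x - k x) f := by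
  refine Lp.ext ?_
  have h : ∀ x, |m x - k x| ≤ C + D := fun x =>
    (abs_sub _ _).trans (add_le_add (hC x) (hD x))
  filter_upwards [coeFn_mulOp hm hC f, coeFn_mulOp hk hD f, Lp.coeFn_sub (mulOp ν m f) (mulOp ν k f),
    coeFn_mulOp (hm.sub hk) h f] with x h1 h2 h3 h4
  rw [h3, Pi.sub_apply, h1, h2]
  refine Eq.trans ?_ h4.symm
  push_cast [Pi.sub_apply]
  ring

theorem inner_mulOp_left {m : ℝ → ℝ} (hm : Measurable m) {C : ℝ} (hC : ∀ x, |m x| ≤ C)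
    (f g : Lp ℂ 2 ν) : ⟪mulOp ν m f, g⟫_ℂ = ⟪f, mulOp ν m g⟫_ℂ := by
  rw [L2.inner_def, L2.inner_def]
  refine integral_congr_ae ?_
  filter_upwards [coeFn_mulOp hm hC f, coeFn_mulOp hm hC g] with x h1 h2
  rw [h1, h2]
  simp only [RCLike.inner_apply, map_mul, Complex.conj_ofReal]
  ring

theorem inner_mulOp_self {m : ℝ → ℝ} (hm : Measurable m) {C : ℝ} (hC : ∀ x, |m x| ≤ C)
    (f : Lp ℂ 2 ν) : ⟪f, mulOp ν m f⟫_ℂ = ((∫ x, m x * ‖f x‖ ^ 2 ∂ν : ℝ) : ℂ) := by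
  rw [L2.inner_def, ← integral_complex_ofReal]
  refine integral_congr_ae ?_
  filter_upwards [coeFn_mulOp hm hC f] with x h1
  rw [h1]
  simp only [RCLike.inner_apply, mul_assoc, Complex.mul_conj', Complex.ofReal_mul,
    Complex.ofReal_pow]

theorem integrable_norm_sq_coeFn (f : Lp ℂ 2 ν) : Integrable (fun x => ‖f x‖ ^ 2) ν :=
  (memLp_two_iff_integrable_sq_norm (Lp.aestronglyMeasurable f)).1 (Lp.memLp f)

/-- Dominated convergence for multiplication operators. -/
theorem tendsto_mulOp {ι : Type*} {l : Filter ι} [l.IsCountablyGenerated] {m : ι → ℝ → ℝ}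
    {k : ℝ → ℝ} {C : ℝ} (hm : ∀ i, Measurable (m i)) (hC : ∀ᶠ i in l, ∀ x, |m i x| ≤ C)
    (hk : Measurable k) (hkC : ∀ x, |k x| ≤ C) (hlim : ∀ x, Tendsto (fun i => m i x) l (𝓝 (k x)))
    (f : Lp ℂ 2 ν) : Tendsto (fun i => mulOp ν (m i) f) l (𝓝 (mulOp ν k f)) := by
  rw [tendsto_iff_norm_sub_tendsto_zero]
  have h1 : Tendsto (fun i => ∫ x, ((m i x - k x) * (m i x - k x)) * ‖f x‖ ^ 2 ∂ν) l
      (𝓝 (∫ x, (0 : ℝ) ∂ν)) := by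
    refine tendsto_integral_filter_of_dominated_convergence
      (fun x => (C + C) * (C + C) * ‖f x‖ ^ 2) ?_ ?_ ?_ ?_
    · refine Eventually.of_forall fun i => ?_
      exact ((((hm i).sub hk).mul ((hm i).sub hk)).aestronglyMeasurable).mul
        (integrable_norm_sq_coeFn f).aestronglyMeasurable
    · filter_upwards [hC] with i hi
      refine Eventually.of_forall fun x => ?_
      rw [norm_mul, norm_mul, Real.norm_of_nonneg (sq_nonneg ‖f x‖), Real.norm_eq_abs]
      have h : |m i x - k x| ≤ C + C := (abs_sub _ _).trans (add_le_add (hi x) (hkC x))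
      have h0 : 0 ≤ C := (abs_nonneg _).trans (hkC x)
      gcongr
    · exact (integrable_norm_sq_coeFn f).const_mul _
    · refine Eventually.of_forall fun x => ?_
      have h2 : Tendsto (fun i => m i x - k x) l (𝓝 0) := by
        simpa using (hlim x).sub_const (k x)
      simpa using (h2.mul h2).mul_const (‖f x‖ ^ 2)
  rw [integral_zero] at h1
  -- The squared norm of the difference is the integral of (m_i - k)² |f|², to which dominated
  -- convergence was just applied.
  have h2 : Tendsto (fun i => ‖mulOp ν (m i) f - mulOp ν k f‖ ^ 2) l (𝓝 0) := by
    refine h1.congr' ?_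
    filter_upwards [hC] with i hi
    have hb : ∀ x, |m i x - k x| ≤ C + C := fun x =>
      (abs_sub _ _).trans (add_le_add (hi x) (hkC x))
    have hb2 : ∀ x, |(m i x - k x) * (m i x - k x)| ≤ (C + C) * (C + C) := fun x => by
      rw [abs_mul]
      exact mul_le_mul (hb x) (hb x) (abs_nonneg _) ((abs_nonneg _).trans (hb x))
    have hme : Measurable fun x => m i x - k x := (hm i).sub hk
    rw [mulOp_sub (hm i) hi hk hkC, @norm_sq_eq_re_inner ℂ, inner_mulOp_left hme hb,
      mulOp_mulOp hme hb hme hb, inner_mulOp_self (m := fun x => (m i x - k x) * (m i x - k x)) (hme.mul hme) hb2]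
    simp
  have h3 := h2.sqrt
  simpa using h3

/-- The truncation of the identity function of the line to `[-n, n]`. -/
def truncId (n : ℕ) (y : ℝ) : ℝ := (Set.Icc (-(n : ℝ)) n).indicator (fun _ => 1) y * y

theorem measurable_truncId (n : ℕ) : Measurable (truncId n) :=
  (measurable_const.indicator measurableSet_Icc).mul measurable_id

theorem abs_truncId_le (n : ℕ) (y : ℝ) : |truncId n y| ≤ n := by
  unfold truncId
  by_cases h : y ∈ Set.Icc (-(n : ℝ)) n
  · simpa [h] using abs_le.2 h
  · simp [h]

theorem mem_Icc_ceil_abs (y : ℝ) : y ∈ Set.Icc (-((⌈|y|⌉₊ : ℕ) : ℝ)) (⌈|y|⌉₊ : ℕ) :=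
  abs_le.1 (Nat.le_ceil _)

theorem abs_indicator_one_le (s : Set ℝ) (x : ℝ) : |s.indicator (fun _ => (1 : ℝ)) x| ≤ 1 := by
  by_cases h : x ∈ s <;> simp [h]

/-- Replaces a relation with an unbounded multiplier by countably many equations between bounded
operators, which makes linearity and closedness of the graph immediate. -/
theorem ae_eq_ofReal_mul_iff (f g : Lp ℂ 2 ν) :
    (g =ᵐ[ν] fun y => (y : ℂ) * f y) ↔ ∀ n : ℕ, mulOp ν (truncId n) f =
      mulOp ν ((Set.Icc (-(n : ℝ)) n).indicator fun _ => 1) g := by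
  have hf := fun n => coeFn_mulOp (measurable_truncId n) (abs_truncId_le n) f
  have hg := fun n : ℕ => coeFn_mulOp (measurable_const.indicator measurableSet_Icc)
    (abs_indicator_one_le (Set.Icc (-(n : ℝ)) n)) g
  constructor
  · intro h n
    refine Lp.ext ?_
    filter_upwards [h, hf n, hg n] with y h1 h2 h3
    rw [h2, h3, h1, truncId]
    push_cast
    ring
  · intro h
    have h3 : ∀ᵐ y ∂ν, ∀ n : ℕ, (truncId n y : ℂ) * f y =
        (((Set.Icc (-(n : ℝ)) n).indicator (fun _ => 1) y : ℝ) : ℂ) * g y := by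
      rw [ae_all_iff]
      intro n
      have h4 := hf n
      rw [h n] at h4
      filter_upwards [h4, hg n] with y h5 h6
      rw [← h5, h6]
    filter_upwards [h3] with y hy
    have h7 := hy ⌈|y|⌉₊
    rw [truncId, Set.indicator_of_mem (mem_Icc_ceil_abs y)] at h7
    simpa using h7.symm

end Multiplication

/-! ### Operators that are unitarily equivalent to a multiplication operator -/

section Transport

variable {ν : Measure ℝ} {H : Type*} [NormedAddCommGroup H] [InnerProductSpace ℂ H]
  (U : H ≃ₗᵢ[ℂ] Lp ℂ 2 ν)

/-- The operator that `U` carries to the multiplication by `m`. -/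
def transportMul (m : ℝ → ℝ) : H →L[ℂ] H :=
  (U.symm.toContinuousLinearEquiv : Lp ℂ 2 ν →L[ℂ] H) ∘L mulOp ν m ∘L
    (U.toContinuousLinearEquiv : H →L[ℂ] Lp ℂ 2 ν)

theorem transportMul_apply (m : ℝ → ℝ) (x : H) :
    transportMul U m x = U.symm (mulOp ν m (U x)) := rfl

theorem inner_symm_left (x : Lp ℂ 2 ν) (y : H) : ⟪U.symm x, y⟫_ℂ = ⟪x, U y⟫_ℂ := by
  rw [← U.inner_map_map, U.apply_symm_apply]

theorem inner_symm_right (x : H) (y : Lp ℂ 2 ν) : ⟪x, U.symm y⟫_ℂ = ⟪U x, y⟫_ℂ := by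
  rw [← U.inner_map_map, U.apply_symm_apply]

theorem transportMul_transportMul {m k : ℝ → ℝ} (hm : Measurable m) {C : ℝ} (hC : ∀ x, |m x| ≤ C)
    (hk : Measurable k) {D : ℝ} (hD : ∀ x, |k x| ≤ D) (x : H) :
    transportMul U m (transportMul U k x) = transportMul U (fun x => m x * k x) x := by
  simp only [transportMul_apply, U.apply_symm_apply, mulOp_mulOp hm hC hk hD]

theorem tendsto_transportMul {ι : Type*} {l : Filter ι} [l.IsCountablyGenerated] {m : ι → ℝ → ℝ}
    {k : ℝ → ℝ} {C : ℝ} (hm : ∀ i, Measurable (m i)) (hC : ∀ᶠ i in l, ∀ x, |m i x| ≤ C)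
    (hk : Measurable k) (hkC : ∀ x, |k x| ≤ C) (hlim : ∀ x, Tendsto (fun i => m i x) l (𝓝 (k x)))
    (x : H) : Tendsto (fun i => transportMul U (m i) x) l (𝓝 (transportMul U k x)) :=
  (U.symm.continuous.tendsto _).comp (tendsto_mulOp hm hC hk hkC hlim (U x))

/-- Cutoffs to [-n, n] lie in the domain of A. They give density of the domain and enough test
vectors to compute the adjoint. -/
theorem transportMul_mem_graph {A : H →ₗ.[ℂ] H}
    (hA : ∀ p : H × H, p ∈ A.graph ↔ U p.2 =ᵐ[ν] fun y => (y : ℂ) * U p.1 y) (n : ℕ) (x : H) :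
    (transportMul U ((Set.Icc (-(n : ℝ)) n).indicator fun _ => 1) x, transportMul U (truncId n) x) ∈
      A.graph := by
  rw [hA]
  simp only [transportMul_apply, U.apply_symm_apply]
  filter_upwards [coeFn_mulOp (measurable_const.indicator measurableSet_Icc)
    (abs_indicator_one_le (Set.Icc (-(n : ℝ)) n)) (U x),
    coeFn_mulOp (measurable_truncId n) (abs_truncId_le n) (U x)] with y h1 h2
  rw [h1, h2, truncId]
  push_cast
  ring

/-- The graph of the operator that `U` carries to the multiplication by the identity function. -/
def mulGraph : Submodule ℂ (H × H) where
  carrier := {p | ∀ n : ℕ, mulOp ν (truncId n) (U p.1) =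
      mulOp ν ((Set.Icc (-(n : ℝ)) n).indicator fun _ => 1) (U p.2)}
  add_mem' hp hq n := by
    simp only [Prod.fst_add, Prod.snd_add, map_add, hp n, hq n]
  zero_mem' n := by simp
  smul_mem' c p hp n := by
    simp only [Prod.smul_fst, Prod.smul_snd, map_smul, hp n]

theorem mem_mulGraph_iff {p : H × H} :
    p ∈ mulGraph U ↔ U p.2 =ᵐ[ν] fun y => (y : ℂ) * U p.1 y :=
  (ae_eq_ofReal_mul_iff (U p.1) (U p.2)).symm

theorem isClosed_mulGraph : IsClosed (mulGraph U : Set (H × H)) := by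
  change IsClosed {p : H × H | ∀ n : ℕ, mulOp ν (truncId n) (U p.1) =
      mulOp ν ((Set.Icc (-(n : ℝ)) n).indicator fun _ => 1) (U p.2)}
  rw [Set.ofPred_forall]
  exact isClosed_iInter fun n => isClosed_eq (by fun_prop) (by fun_prop)

/-- For p = (f, Af) the number ⟨Af, f⟩ is real, so the cross term vanishes and ‖Af + if‖² = ‖Af‖² +
‖f‖². -/
theorem norm_le_norm_add_I_smul {p : H × H} (hp : p ∈ mulGraph U) :
    ‖p‖ ≤ ‖p.2 + Complex.I • p.1‖ := by
  rw [mem_mulGraph_iff] at hp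
  have h0 : (⟪p.2, Complex.I • p.1⟫_ℂ).re = 0 := by
    rw [inner_smul_right, ← U.inner_map_map, L2.inner_def]
    have h1 : ∫ y, ⟪U p.2 y, U p.1 y⟫_ℂ ∂ν = ((∫ y, y * ‖U p.1 y‖ ^ 2 ∂ν : ℝ) : ℂ) := by
      rw [← integral_complex_ofReal]
      refine integral_congr_ae ?_
      filter_upwards [hp] with y hy
      rw [hy]
      simp only [RCLike.inner_apply, map_mul, Complex.conj_ofReal, Complex.ofReal_mul,
        Complex.ofReal_pow, ← Complex.mul_conj']
      ring
    rw [h1]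
    simp
  have h2 := norm_add_sq (𝕜 := ℂ) p.2 (Complex.I • p.1)
  rw [RCLike.re_to_complex, h0, mul_zero, add_zero, norm_smul, Complex.norm_I, one_mul] at h2
  rw [Prod.norm_def]
  refine max_le ?_ ?_
  · exact le_of_sq_le_sq (by rw [h2]; nlinarith [sq_nonneg ‖p.2‖]) (norm_nonneg _)
  · exact le_of_sq_le_sq (by rw [h2]; nlinarith [sq_nonneg ‖p.1‖]) (norm_nonneg _)

/-- A criterion for a subspace of the graph of a multiplication operator to be a core. -/
theorem topologicalClosure_eq_mulGraph {K : Submodule ℂ (H × H)} (hK : K ≤ mulGraph U)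
    (hd : Dense {x : H | ∃ p ∈ K, p.2 + Complex.I • p.1 = x}) :
    K.topologicalClosure = mulGraph U := by
  refine le_antisymm (K.topologicalClosure_minimal hK (isClosed_mulGraph U)) fun p hp => ?_
  change p ∈ closure (K : Set (H × H))
  rw [Metric.mem_closure_iff]
  intro ε hε
  obtain ⟨x, hx, ⟨q, hq, rfl⟩⟩ := Metric.dense_iff.1 hd (p.2 + Complex.I • p.1) ε hε
  refine ⟨q, hq, ?_⟩
  rw [dist_eq_norm]
  -- Closeness of the images under A + i forces closeness in the graph norm.
  refine (norm_le_norm_add_I_smul U (sub_mem hp (hK hq))).trans_lt ?_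
  rw [Metric.mem_ball, dist_comm, dist_eq_norm] at hx
  have e : (p - q).2 + Complex.I • (p - q).1 =
      p.2 + Complex.I • p.1 - (q.2 + Complex.I • q.1) := by
    rw [Prod.snd_sub, Prod.fst_sub, smul_sub]
    abel
  rwa [e]

variable [CompleteSpace H]

/-- The spectral measure that `U` carries to the multiplication by indicator functions. -/
def spectralMeasureOfUnitary : SpectralMeasure H where
  proj s := transportMul U (s.indicator fun _ => 1)
  isStarProjection_proj s hs := by
    have hm : Measurable (s.indicator fun _ => (1 : ℝ)) := measurable_const.indicator hs
    refine ⟨?_, ?_⟩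
    · ext x
      rw [mul_apply_eq_comp, transportMul_transportMul U hm (abs_indicator_one_le s) hm
        (abs_indicator_one_le s)]
      congr 2
      funext y
      by_cases h : y ∈ s <;> simp [h]
    · rw [ContinuousLinearMap.isSelfAdjoint_iff_isSymmetric]
      intro x y
      simp only [ContinuousLinearMap.coe_coe, transportMul_apply, inner_symm_left,
        inner_symm_right, inner_mulOp_left hm (abs_indicator_one_le s)]
  proj_univ := by
    ext x
    simp only [Set.indicator_univ, transportMul_apply, mulOp_one, U.symm_apply_apply,
      one_apply_eq_self]
  proj_inter s t hs ht := by
    ext x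
    rw [mul_apply_eq_comp, transportMul_transportMul U (measurable_const.indicator hs)
      (abs_indicator_one_le s) (measurable_const.indicator ht) (abs_indicator_one_le t)]
    congr 2
    funext y
    by_cases h : y ∈ s <;> by_cases h' : y ∈ t <;> simp [h, h']
  hasSum_proj_iUnion s hs hd x := by
    have hsum : ∀ F : Finset ℕ, ∑ i ∈ F, transportMul U ((s i).indicator fun _ => 1) x =
        transportMul U ((⋃ i ∈ F, s i).indicator fun _ => 1) x := by
      intro F
      induction F using Finset.induction_on with
      | empty =>
        refine (transportMul_apply U _ x).symm ▸ ?_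
        have h0 : mulOp ν ((⋃ i ∈ (∅ : Finset ℕ), s i).indicator fun _ => 1) (U x) = 0 := by
          refine Lp.ext ?_
          filter_upwards [coeFn_mulOp (measurable_const.indicator (by simp))
            (abs_indicator_one_le (⋃ i ∈ (∅ : Finset ℕ), s i)) (U x), Lp.coeFn_zero ℂ 2 ν]
            with y h1 h2
          rw [h1, h2]
          simp
        rw [h0, map_zero, Finset.sum_empty]
      | insert a F ha ih =>
        have hF : MeasurableSet (⋃ i ∈ F, s i) := F.measurableSet_biUnion fun i _ => hs i
        have hF' : MeasurableSet (⋃ i ∈ insert a F, s i) :=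
          (insert a F).measurableSet_biUnion fun i _ => hs i
        rw [Finset.sum_insert ha, ih]
        simp only [transportMul_apply]
        rw [← map_add]
        congr 1
        refine Lp.ext ?_
        filter_upwards [coeFn_mulOp (measurable_const.indicator (hs a))
          (abs_indicator_one_le (s a)) (U x), coeFn_mulOp (measurable_const.indicator hF)
          (abs_indicator_one_le (⋃ i ∈ F, s i)) (U x), coeFn_mulOp (measurable_const.indicator hF')
          (abs_indicator_one_le (⋃ i ∈ insert a F, s i)) (U x), Lp.coeFn_add
          (mulOp ν ((s a).indicator fun _ => 1) (U x))
          (mulOp ν ((⋃ i ∈ F, s i).indicator fun _ => 1) (U x))] with y h1 h2 h3 h4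
        rw [h4, Pi.add_apply, h1, h2, h3, ← add_mul, ← Complex.ofReal_add]
        congr 2
        have hdis : Disjoint (s a) (⋃ i ∈ F, s i) := by
          rw [Set.disjoint_iUnion₂_right]
          intro i hi
          exact hd (by rintro rfl; exact ha hi)
        rw [Finset.set_biUnion_insert, Set.indicator_union_of_disjoint hdis]
    -- At each point the indicators are eventually constant along the finite sets F, so dominated
    -- convergence applies.
    have hlim : Tendsto (fun F : Finset ℕ => transportMul U ((⋃ i ∈ F, s i).indicator fun _ => 1) x)
        atTop (𝓝 (transportMul U ((⋃ i, s i).indicator fun _ => 1) x)) := by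
      refine tendsto_transportMul U (C := 1) (fun F => measurable_const.indicator
        (F.measurableSet_biUnion fun i _ => hs i)) (Eventually.of_forall fun F =>
        abs_indicator_one_le _) (measurable_const.indicator (MeasurableSet.iUnion hs))
        (abs_indicator_one_le _) (fun y => ?_) x
      refine tendsto_const_nhds.congr' ?_
      by_cases hy : ∃ i, y ∈ s i
      · obtain ⟨i, hi⟩ := hy
        filter_upwards [eventually_ge_atTop {i}] with F hF
        rw [Set.indicator_of_mem (Set.mem_iUnion.2 ⟨i, hi⟩), Set.indicator_of_mem]
        exact Set.mem_biUnion (Finset.singleton_subset_iff.1 hF) hi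
      · refine Eventually.of_forall fun F => ?_
        push Not at hy
        simp [hy]
    unfold HasSum
    simpa only [hsum, SummationFilter.unconditional_filter] using hlim

/-- Reduces every integral against the spectral measure to one against |Ux|² dν. -/
theorem diag_spectralMeasureOfUnitary (x : H) :
    (spectralMeasureOfUnitary U).diag x = ν.withDensity fun y => ENNReal.ofReal (‖U x y‖ ^ 2) := by
  refine Measure.ext fun s hs => ?_
  have hm : Measurable (s.indicator fun _ => (1 : ℝ)) := measurable_const.indicator hs
  rw [SpectralMeasure.diag, Measure.ofMeasurable_apply _ hs, withDensity_apply _ hs]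
  change ENNReal.ofReal (⟪x, transportMul U (s.indicator fun _ => 1) x⟫_ℂ).re = _
  rw [transportMul_apply, inner_symm_right, inner_mulOp_self hm (abs_indicator_one_le s),
    Complex.ofReal_re]
  have h : (fun y => s.indicator (fun _ => (1 : ℝ)) y * ‖U x y‖ ^ 2) =
      s.indicator fun y => ‖U x y‖ ^ 2 := by
    funext y
    by_cases hy : y ∈ s <;> simp [hy]
  rw [h, integral_indicator hs, ofReal_integral_eq_lintegral_ofReal
    (integrable_norm_sq_coeFn (U x)).integrableOn (Eventually.of_forall fun y => sq_nonneg _)]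

theorem integrable_diag_iff (x : H) (g : ℝ → ℝ) :
    Integrable g ((spectralMeasureOfUnitary U).diag x) ↔ Integrable (fun y => ‖U x y‖ ^ 2 * g y) ν := by
  rw [diag_spectralMeasureOfUnitary, integrable_withDensity_iff_integrable_smul₀'
    (integrable_norm_sq_coeFn (U x)).aestronglyMeasurable.aemeasurable.ennreal_ofReal
    (Eventually.of_forall fun _ => ENNReal.ofReal_lt_top)]
  simp only [ENNReal.toReal_ofReal (sq_nonneg _), smul_eq_mul]

theorem integral_diag (x : H) (g : ℝ → ℝ) :
    ∫ l, g l ∂((spectralMeasureOfUnitary U).diag x) = ∫ y, ‖U x y‖ ^ 2 * g y ∂ν := by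
  rw [diag_spectralMeasureOfUnitary, integral_withDensity_eq_integral_toReal_smul₀
    (integrable_norm_sq_coeFn (U x)).aestronglyMeasurable.aemeasurable.ennreal_ofReal
    (Eventually.of_forall fun _ => ENNReal.ofReal_lt_top)]
  simp only [ENNReal.toReal_ofReal (sq_nonneg _), smul_eq_mul]

theorem isIntegral_transportMul {m : ℝ → ℝ} (hm : Measurable m) {C : ℝ} (hC : ∀ x, |m x| ≤ C) :
    (spectralMeasureOfUnitary U).IsIntegral m (transportMul U m) := by
  intro x
  rw [integral_diag, transportMul_apply, inner_symm_right, inner_mulOp_self hm hC]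
  simp only [mul_comm]

variable {U} {A : H →ₗ.[ℂ] H}

theorem isSpectralMeasureOf_of_mem_graph_iff
    (hA : ∀ p : H × H, p ∈ A.graph ↔ U p.2 =ᵐ[ν] fun y => (y : ℂ) * U p.1 y) :
    (spectralMeasureOfUnitary U).IsSpectralMeasureOf A := by
  constructor
  · intro x
    rw [integrable_diag_iff]
    have hm : AEStronglyMeasurable (fun y : ℝ => (y : ℂ) * U x y) ν :=
      AEStronglyMeasurable.mul (by fun_prop) (Lp.aestronglyMeasurable (U x))
    have h1 : Integrable (fun y : ℝ => ‖U x y‖ ^ 2 * y ^ 2) ν ↔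
        MemLp (fun y : ℝ => (y : ℂ) * U x y) 2 ν := by
      rw [memLp_two_iff_integrable_sq_norm hm]
      refine integrable_congr (Eventually.of_forall fun y => ?_)
      simp only [norm_mul, Complex.norm_real, mul_pow, Real.norm_eq_abs, sq_abs]
      ring
    rw [h1, LinearPMap.mem_domain_iff]
    constructor
    · rintro ⟨y, hy⟩
      exact (Lp.memLp (U y)).ae_eq ((hA (x, y)).1 hy)
    · intro h
      refine ⟨U.symm (h.toLp _), (hA _).2 ?_⟩
      rw [U.apply_symm_apply]
      exact h.coeFn_toLp
  · intro x
    have h := (hA (x, A x)).1 (A.mem_graph x)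
    rw [integral_diag, ← U.inner_map_map, L2.inner_def, ← integral_complex_ofReal]
    refine integral_congr_ae ?_
    filter_upwards [h] with y hy
    rw [hy]
    simp only [RCLike.inner_apply, mul_assoc, Complex.mul_conj', Complex.ofReal_mul,
      Complex.ofReal_pow]
    ring

theorem isSelfAdjoint_of_mem_graph_iff
    (hA : ∀ p : H × H, p ∈ A.graph ↔ U p.2 =ᵐ[ν] fun y => (y : ℂ) * U p.1 y) :
    IsSelfAdjoint A := by
  have hdense : Dense (A.domain : Set H) := by
    intro x
    have h1 : Tendsto (fun n : ℕ =>
        transportMul U ((Set.Icc (-(n : ℝ)) n).indicator fun _ => 1) x) atTop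
        (𝓝 (transportMul U (fun _ => 1) x)) := by
      refine tendsto_transportMul U (C := 1)
        (fun n => measurable_const.indicator measurableSet_Icc)
        (Eventually.of_forall fun n => abs_indicator_one_le _) measurable_const (by simp)
        (fun y => ?_) x
      refine tendsto_const_nhds.congr' ?_
      filter_upwards [eventually_ge_atTop ⌈|y|⌉₊] with n hn
      rw [Set.indicator_of_mem]
      exact abs_le.1 ((Nat.le_ceil _).trans (Nat.cast_le.2 hn))
    rw [transportMul_apply U (fun _ => 1), mulOp_one, U.symm_apply_apply] at h1
    refine mem_closure_of_tendsto h1 (Eventually.of_forall fun n => ?_)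
    exact LinearPMap.mem_domain_of_mem_graph (transportMul_mem_graph U hA n x)
  rw [LinearPMap.isSelfAdjoint_def]
  apply LinearPMap.eq_of_eq_graph
  rw [LinearPMap.adjoint_graph_eq_graph_adjoint hdense]
  ext p
  rw [Submodule.mem_adjoint_iff, hA]
  constructor
  · intro h
    rw [ae_eq_ofReal_mul_iff]
    intro n
    -- The adjoint relation is tested on the cutoffs of an arbitrary vector k; the bounded symmetric
    -- multipliers then move from k to the components of p.
    refine ext_inner_left ℂ fun k => ?_
    have h2 := h _ _ (transportMul_mem_graph U hA n (U.symm k))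
    simp only [transportMul_apply, U.apply_symm_apply, inner_symm_left] at h2
    rw [inner_mulOp_left (measurable_truncId n) (abs_truncId_le n), inner_mulOp_left
      (measurable_const.indicator measurableSet_Icc) (abs_indicator_one_le _)] at h2
    exact sub_eq_zero.1 h2
  · intro h a b hab
    have hab := (hA _).1 hab
    rw [sub_eq_zero, ← U.inner_map_map, ← U.inner_map_map a, L2.inner_def, L2.inner_def]
    refine integral_congr_ae ?_
    filter_upwards [h, hab] with y h1 h2
    rw [h1, h2]
    simp only [RCLike.inner_apply, map_mul, Complex.conj_ofReal]
    ring

end Transport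

namespace BoseLike

/-! ### The Hermite basis and the generalized Fourier transform -/

theorem memLp_hermiteBase {μ : ℝ} (hμ : -(1 / 2) < μ) (n : ℕ) :
    MemLp (fun x => (hermiteBase μ n x : ℂ)) 2 (weightMeasure μ) := by
  obtain ⟨C, hC, h⟩ := exists_abs_hermiteBase_le μ n
  have := continuous_hermiteBase μ n
  refine memLp_weight_of_norm_le hμ one_half_pos (C := C) (c := 2) (by fun_prop) fun x => ?_
  rw [Complex.norm_real]
  exact h x

/-- The function `hermiteBase μ n` as an element of `L2 μ`. -/
def hermiteVec {μ : ℝ} (hμ : -(1 / 2) < μ) (n : ℕ) : L2 μ := (memLp_hermiteBase hμ n).toLp _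

theorem coeFn_hermiteVec {μ : ℝ} (hμ : -(1 / 2) < μ) (n : ℕ) :
    hermiteVec hμ n =ᵐ[weightMeasure μ] fun x => (hermiteBase μ n x : ℂ) :=
  MemLp.coeFn_toLp _

theorem inner_hermiteVec_left {μ : ℝ} (hμ : -(1 / 2) < μ) (n : ℕ) (f : L2 μ) :
    ⟪hermiteVec hμ n, f⟫_ℂ = ∫ x, f x * (hermiteBase μ n x : ℂ) ∂(weightMeasure μ) := by
  rw [L2.inner_def]
  refine integral_congr_ae ?_
  filter_upwards [coeFn_hermiteVec hμ n] with x hx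
  rw [hx]
  simp [RCLike.inner_apply]

theorem inner_hermiteVec {μ : ℝ} (hμ : -(1 / 2) < μ) (m n : ℕ) :
    ⟪hermiteVec hμ m, hermiteVec hμ n⟫_ℂ = if m = n then (hermiteNormSq μ n : ℂ) else 0 := by
  have h : ⟪hermiteVec hμ m, hermiteVec hμ n⟫_ℂ = (hermiteGram μ m n : ℂ) := by
    rw [inner_hermiteVec_left, hermiteGram, ← integral_complex_ofReal]
    refine integral_congr_ae ?_
    filter_upwards [coeFn_hermiteVec hμ n] with x hx
    rw [hx, mul_comm, Complex.ofReal_mul]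
  rw [h, hermiteGram_eq hμ]
  split_ifs <;> simp

theorem eq_zero_of_inner_hermiteVec {μ : ℝ} (hμ : -(1 / 2) < μ) {f : L2 μ}
    (hf : ∀ n, ⟪hermiteVec hμ n, f⟫_ℂ = 0) : f = 0 := by
  rw [Lp.eq_zero_iff_ae_eq_zero]
  exact ae_eq_zero_of_hermiteBase_orthogonal hμ (integrable_mul_exp_of_memLp hμ (Lp.memLp f))
    fun n => by rw [← inner_hermiteVec_left hμ, hf]

/-- The Hermite basis with its elements multiplied by the phases `c n`. -/
def hermiteBasisPhase {μ : ℝ} (hμ : -(1 / 2) < μ) (c : ℕ → ℂ) (hc : ∀ n, ‖c n‖ = 1) :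
    HilbertBasis ℕ ℂ (L2 μ) :=
  HilbertBasis.mkOfOrthogonalEqBot
    (v := fun n => (c n * ((Real.sqrt (hermiteNormSq μ n))⁻¹ : ℝ)) • hermiteVec hμ n)
    (by
      rw [orthonormal_iff_ite]
      intro m n
      rw [inner_smul_left, inner_smul_right, inner_hermiteVec]
      split_ifs with h
      · subst h
        have h1 := hermiteNormSq_pos hμ m
        have h2 : (starRingEnd ℂ) (c m) * c m = 1 := by rw [Complex.conj_mul', hc]; simp
        have h3 : (Real.sqrt (hermiteNormSq μ m))⁻¹ * (Real.sqrt (hermiteNormSq μ m))⁻¹ *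
            hermiteNormSq μ m = 1 := by
          rw [← mul_inv, Real.mul_self_sqrt h1.le, inv_mul_cancel₀ h1.ne']
        rw [map_mul, Complex.conj_ofReal]
        calc _ = ((starRingEnd ℂ) (c m) * c m) * (((Real.sqrt (hermiteNormSq μ m))⁻¹ *
              (Real.sqrt (hermiteNormSq μ m))⁻¹ * hermiteNormSq μ m : ℝ) : ℂ) := by
              push_cast; ring
          _ = 1 := by rw [h2, h3]; simp
      · simp)
    (by
      rw [Submodule.eq_bot_iff]
      intro f hf
      refine eq_zero_of_inner_hermiteVec hμ fun n => ?_
      have h1 := (Submodule.mem_orthogonal _ _).1 hf _ (Submodule.subset_span ⟨n, rfl⟩)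
      rw [inner_smul_left] at h1
      refine (mul_eq_zero.1 h1).resolve_left ?_
      rw [map_eq_zero]
      refine mul_ne_zero (fun h => ?_) ?_
      · have := hc n; rw [h, norm_zero] at this; exact zero_ne_one this
      · exact_mod_cast inv_ne_zero (Real.sqrt_ne_zero'.2 (hermiteNormSq_pos hμ n)))

theorem hermiteBasisPhase_apply {μ : ℝ} (hμ : -(1 / 2) < μ) (c : ℕ → ℂ) (hc : ∀ n, ‖c n‖ = 1)
    (n : ℕ) : hermiteBasisPhase hμ c hc n =
      (c n * ((Real.sqrt (hermiteNormSq μ n))⁻¹ : ℝ)) • hermiteVec hμ n := by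
  rw [hermiteBasisPhase, HilbertBasis.coe_mkOfOrthogonalEqBot]

/-- The generalized Fourier transform: the unitary operator with eigenvectors the Hermite functions
and eigenvalues `(-i)ⁿ`. -/
def dunklTransform {μ : ℝ} (hμ : -(1 / 2) < μ) : L2 μ ≃ₗᵢ[ℂ] L2 μ :=
  (hermiteBasisPhase hμ (fun _ => 1) (by simp)).repr.trans
    (hermiteBasisPhase hμ (fun n => (-Complex.I) ^ n) (by simp)).repr.symm

theorem dunklTransform_hermiteVec {μ : ℝ} (hμ : -(1 / 2) < μ) (n : ℕ) :
    dunklTransform hμ (hermiteVec hμ n) = (-Complex.I) ^ n • hermiteVec hμ n := by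
  classical
  have h1 : dunklTransform hμ (hermiteBasisPhase hμ (fun _ => 1) (by simp) n) =
      hermiteBasisPhase hμ (fun n => (-Complex.I) ^ n) (by simp) n := by
    rw [dunklTransform, LinearIsometryEquiv.trans_apply, HilbertBasis.repr_self,
      HilbertBasis.repr_symm_single]
  rw [hermiteBasisPhase_apply, hermiteBasisPhase_apply, map_smul, one_mul, mul_comm, mul_smul] at h1
  refine smul_right_injective _ ?_ h1
  exact_mod_cast inv_ne_zero (Real.sqrt_ne_zero'.2 (hermiteNormSq_pos hμ n))

/-! ### The operator `P` on the Hermite functions -/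

theorem hasDerivAt_gaussConv {e e' : ℕ → ℝ → ℝ} {x : ℝ} (he : ∀ m, HasDerivAt (e m) (e' m x) x)
    (n : ℕ) : HasDerivAt (fun x => gaussConv (fun m => e m x) n) (gaussConv (fun m => e' m x) n) x := by
  unfold gaussConv
  exact HasDerivAt.fun_sum fun p _ => (he p.2).const_mul _

theorem gaussConv_shift (e : ℕ → ℝ) (h0 : e 0 = 0) (n : ℕ) :
    gaussConv e (n + 1) = gaussConv (fun m => e (m + 1)) n := by
  rw [gaussConv, Finset.Nat.sum_antidiagonal_succ', gaussConv, h0, mul_zero, zero_add]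

/-- The Dunkl derivative of `hermiteCoeff μ n`. -/
def hermiteCoeffDunkl (μ : ℝ) (n : ℕ) (x : ℝ) : ℝ :=
  deriv (hermiteCoeff μ n) x + μ / x * (hermiteCoeff μ n x - hermiteCoeff μ n (-x))

theorem differentiable_hermiteCoeff (μ : ℝ) (n : ℕ) : Differentiable ℝ (hermiteCoeff μ n) := by
  unfold hermiteCoeff gaussConv
  fun_prop

/-- The Dunkl derivative sends xᵐ to θ(m) xᵐ⁻¹: the difference quotient adds 2μ exactly when m is
odd. The truncated exponent at m = 0 is harmless, as θ(0) = 0. -/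
theorem hermiteCoeffDunkl_eq (μ : ℝ) (n : ℕ) {x : ℝ} (hx : x ≠ 0) :
    hermiteCoeffDunkl μ n x =
      gaussConv (fun m => 2 * (dunklFactor μ m * ((2 * x) ^ (m - 1) / genFactorial μ m))) n := by
  have h1 : HasDerivAt (hermiteCoeff μ n)
      (gaussConv (fun m => (m * (2 * x) ^ (m - 1) * 2) / genFactorial μ m) n) x := by
    refine hasDerivAt_gaussConv (e := fun m x => (2 * x) ^ m / genFactorial μ m)
      (e' := fun m x => (m * (2 * x) ^ (m - 1) * 2) / genFactorial μ m) (fun m => ?_) n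
    exact ((hasDerivAt_const_mul (x := x) (2 : ℝ)).pow m).div_const _
  rw [hermiteCoeffDunkl, h1.deriv, hermiteCoeff, hermiteCoeff, gaussConv, gaussConv, gaussConv,
    gaussConv, ← Finset.sum_sub_distrib, Finset.mul_sum, ← Finset.sum_add_distrib]
  refine Finset.sum_congr rfl fun p _ => ?_
  rcases Nat.eq_zero_or_pos p.2 with h | h
  · simp [h, dunklFactor]
  · obtain ⟨k, hk⟩ : ∃ k, p.2 = k + 1 := ⟨p.2 - 1, by omega⟩
    rw [hk, Nat.add_sub_cancel, show 2 * -x = -(2 * x) by ring, dunklFactor]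
    by_cases ho : Odd (k + 1)
    · rw [ho.neg_pow, if_pos ho]
      field_simp
      ring
    · rw [(Nat.not_odd_iff_even.1 ho).neg_pow, if_neg ho]
      ring

theorem hermiteCoeffDunkl_zero {μ : ℝ} {x : ℝ} (hx : x ≠ 0) :
    hermiteCoeffDunkl μ 0 x = 0 := by
  rw [hermiteCoeffDunkl_eq μ 0 hx, gaussConv_zero, dunklFactor_zero]
  ring

theorem hermiteCoeffDunkl_succ {μ : ℝ} (hμ : -(1 / 2) < μ) (n : ℕ) {x : ℝ} (hx : x ≠ 0) :
    hermiteCoeffDunkl μ (n + 1) x = 2 * hermiteCoeff μ n x := by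
  rw [hermiteCoeffDunkl_eq μ _ hx, gaussConv_shift _ (by simp [dunklFactor_zero]), hermiteCoeff,
    gaussConv, gaussConv, Finset.mul_sum]
  refine Finset.sum_congr rfl fun p _ => ?_
  have h1 := (genFactorial_pos hμ p.2).ne'
  have h2 := (dunklFactor_succ_pos hμ p.2).ne'
  rw [genFactorial_succ hμ, Nat.add_sub_cancel]
  field_simp

theorem hermiteBase_neg (μ : ℝ) (n : ℕ) (x : ℝ) :
    hermiteBase μ n (-x) = Real.exp (-x ^ 2 / 2) * hermiteCoeff μ n (-x) := by
  rw [hermiteBase, neg_sq]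

theorem momentumExpr_hermiteBase (μ : ℝ) (n : ℕ) (x : ℝ) :
    momentumExpr μ (fun x => (hermiteBase μ n x : ℂ)) x =
      -Complex.I * ((Real.exp (-x ^ 2 / 2) * hermiteCoeffDunkl μ n x - x * hermiteBase μ n x : ℝ) : ℂ) := by
  have h1 : HasDerivAt (fun x : ℝ => Real.exp (-x ^ 2 / 2)) (Real.exp (-x ^ 2 / 2) * (-x)) x := by
    have h2 : HasDerivAt (fun x : ℝ => -x ^ 2 / 2) (-x) x :=
      ((hasDerivAt_pow 2 x).neg.div_const 2).congr_deriv (by push_cast; ring)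
    exact h2.exp
  have h3 : HasDerivAt (hermiteBase μ n) (Real.exp (-x ^ 2 / 2) * (-x) * hermiteCoeff μ n x +
      Real.exp (-x ^ 2 / 2) * deriv (hermiteCoeff μ n) x) x :=
    h1.mul (differentiable_hermiteCoeff μ n x).hasDerivAt
  rw [momentumExpr, h3.ofReal_comp.deriv, hermiteBase_neg, hermiteBase, hermiteCoeffDunkl]
  congr 1
  push_cast
  ring

theorem momentumExpr_hermiteBase_zero {μ : ℝ} (hμ : -(1 / 2) < μ) {x : ℝ} (hx : x ≠ 0) :
    momentumExpr μ (fun x => (hermiteBase μ 0 x : ℂ)) x =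
      -Complex.I * -(((dunklFactor μ 1 / 2 : ℝ) : ℂ) * (hermiteBase μ 1 x : ℂ)) := by
  rw [momentumExpr_hermiteBase, hermiteCoeffDunkl_zero hx]
  have := hermiteBase_one hμ x
  rw [show Real.exp (-x ^ 2 / 2) * 0 - x * hermiteBase μ 0 x =
    -((dunklFactor μ 1 / 2) * hermiteBase μ 1 x) by linear_combination (-1 / 2) * this]
  push_cast
  ring

/-- The Gaussian is even, so the Dunkl derivative of ψ_{n+1} is 2ψ_n - x ψ_{n+1}. Since x ψ_{n+1} =
ψ_n + (θ(n+2)/2) ψ_{n+2}, it differs from x ψ_{n+1} only in the sign of the second term. -/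
theorem momentumExpr_hermiteBase_succ {μ : ℝ} (hμ : -(1 / 2) < μ) (n : ℕ) {x : ℝ} (hx : x ≠ 0) :
    momentumExpr μ (fun x => (hermiteBase μ (n + 1) x : ℂ)) x =
      -Complex.I * ((hermiteBase μ n x : ℂ) -
        ((dunklFactor μ (n + 2) / 2 : ℝ) : ℂ) * (hermiteBase μ (n + 2) x : ℂ)) := by
  rw [momentumExpr_hermiteBase, hermiteCoeffDunkl_succ hμ n hx]
  have := hermiteBase_succ_succ hμ n x
  rw [show Real.exp (-x ^ 2 / 2) * (2 * hermiteCoeff μ n x) - x * hermiteBase μ (n + 1) x =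
    hermiteBase μ n x - (dunklFactor μ (n + 2) / 2) * hermiteBase μ (n + 2) x by
      rw [show Real.exp (-x ^ 2 / 2) * (2 * hermiteCoeff μ n x) = 2 * hermiteBase μ n x by
        rw [hermiteBase]; ring]
      linear_combination (-1 / 2) * this]
  push_cast
  ring

/-- The value of `P` at `hermiteVec hμ n`. -/
def momentumVec {μ : ℝ} (hμ : -(1 / 2) < μ) : ℕ → L2 μ
  | 0 => Complex.I • ((dunklFactor μ 1 / 2 : ℝ) : ℂ) • hermiteVec hμ 1
  | n + 1 => -Complex.I • (hermiteVec hμ n - ((dunklFactor μ (n + 2) / 2 : ℝ) : ℂ) •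
      hermiteVec hμ (n + 2))

theorem ae_weightMeasure_ne_zero (μ : ℝ) : ∀ᵐ x ∂(weightMeasure μ), x ≠ 0 := by
  have h : ∀ᵐ x : ℝ, x ≠ 0 := by simp [ae_iff, measure_singleton]
  exact (weightMeasure_absolutelyContinuous_volume μ).ae_le h

theorem coeFn_momentumVec {μ : ℝ} (hμ : -(1 / 2) < μ) (n : ℕ) :
    momentumVec hμ n =ᵐ[weightMeasure μ] momentumExpr μ (fun x => (hermiteBase μ n x : ℂ)) := by
  rcases n with _ | n
  · filter_upwards [ae_weightMeasure_ne_zero μ, coeFn_hermiteVec hμ 1,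
      Lp.coeFn_smul Complex.I (((dunklFactor μ 1 / 2 : ℝ) : ℂ) • hermiteVec hμ 1),
      Lp.coeFn_smul ((dunklFactor μ 1 / 2 : ℝ) : ℂ) (hermiteVec hμ 1)] with x hx h1 h2 h3
    rw [momentumExpr_hermiteBase_zero hμ hx, momentumVec, h2, Pi.smul_apply, h3, Pi.smul_apply, h1]
    simp only [smul_eq_mul]
    ring
  · filter_upwards [ae_weightMeasure_ne_zero μ, coeFn_hermiteVec hμ n, coeFn_hermiteVec hμ (n + 2),
      Lp.coeFn_smul (-Complex.I) (hermiteVec hμ n - ((dunklFactor μ (n + 2) / 2 : ℝ) : ℂ) •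
      hermiteVec hμ (n + 2)), Lp.coeFn_sub (hermiteVec hμ n)
      (((dunklFactor μ (n + 2) / 2 : ℝ) : ℂ) • hermiteVec hμ (n + 2)),
      Lp.coeFn_smul ((dunklFactor μ (n + 2) / 2 : ℝ) : ℂ) (hermiteVec hμ (n + 2))]
      with x hx h1 h2 h3 h4 h5
    rw [momentumExpr_hermiteBase_succ hμ n hx, momentumVec, h3, Pi.smul_apply, h4, Pi.sub_apply, h5,
      Pi.smul_apply, h1, h2]
    simp only [smul_eq_mul]

/-- This is U P ψ_n = x U ψ_n. The indices n and n + 2 acquire phases differing by (-i)² = -1, which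
turns the minus sign in P ψ_{n+1} into the plus sign of the recurrence for x ψ_{n+1}. -/
theorem dunklTransform_momentumVec {μ : ℝ} (hμ : -(1 / 2) < μ) (n : ℕ) :
    dunklTransform hμ (momentumVec hμ n) =ᵐ[weightMeasure μ]
      fun x => (-Complex.I) ^ n * (x * (hermiteBase μ n x : ℂ)) := by
  rcases n with _ | n
  · have h0 : dunklTransform hμ (momentumVec hμ 0) =
        ((dunklFactor μ 1 / 2 : ℝ) : ℂ) • hermiteVec hμ 1 := by
      rw [momentumVec, map_smul, map_smul, dunklTransform_hermiteVec, pow_one, smul_smul, smul_smul]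
      congr 1
      linear_combination (-((dunklFactor μ 1 / 2 : ℝ) : ℂ)) * Complex.I_mul_I
    rw [h0]
    filter_upwards [coeFn_hermiteVec hμ 1,
      Lp.coeFn_smul ((dunklFactor μ 1 / 2 : ℝ) : ℂ) (hermiteVec hμ 1)] with x h1 h2
    rw [h2, Pi.smul_apply, h1, pow_zero, one_mul, smul_eq_mul, ← Complex.ofReal_mul,
      ← Complex.ofReal_mul]
    congr 1
    linear_combination (-1 / 2) * hermiteBase_one hμ x
  · have h0 : dunklTransform hμ (momentumVec hμ (n + 1)) = (-Complex.I) ^ (n + 1) •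
        (hermiteVec hμ n + ((dunklFactor μ (n + 2) / 2 : ℝ) : ℂ) • hermiteVec hμ (n + 2)) := by
      rw [momentumVec, map_smul, map_sub, map_smul, dunklTransform_hermiteVec,
        dunklTransform_hermiteVec, smul_sub, smul_add, smul_smul, smul_smul, smul_smul, smul_smul,
        sub_eq_add_neg, ← neg_smul]
      congr 2
      · ring
      · have : (-Complex.I) ^ (n + 2) = -(-Complex.I) ^ n := by
          rw [pow_add]; simp
        rw [this, pow_succ]
        ring
    rw [h0]
    filter_upwards [coeFn_hermiteVec hμ n, coeFn_hermiteVec hμ (n + 2),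
      Lp.coeFn_smul ((-Complex.I) ^ (n + 1)) (hermiteVec hμ n +
      ((dunklFactor μ (n + 2) / 2 : ℝ) : ℂ) • hermiteVec hμ (n + 2)), Lp.coeFn_add (hermiteVec hμ n)
      (((dunklFactor μ (n + 2) / 2 : ℝ) : ℂ) • hermiteVec hμ (n + 2)),
      Lp.coeFn_smul ((dunklFactor μ (n + 2) / 2 : ℝ) : ℂ) (hermiteVec hμ (n + 2))]
      with x h1 h2 h3 h4 h5
    rw [h3, Pi.smul_apply, h4, Pi.add_apply, h5, Pi.smul_apply, h1, h2, smul_eq_mul, smul_eq_mul,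
      ← Complex.ofReal_mul, ← Complex.ofReal_mul, ← Complex.ofReal_add]
    congr 2
    linear_combination (-1 / 2) * hermiteBase_succ_succ hμ n x

/-! ### The graph of `P` -/

theorem hermiteFun_eq (μ : ℝ) (n : ℕ) :
    hermiteFun μ n = ((Real.sqrt (genFactorial μ n / Real.Gamma (μ + 1 / 2)) / 2 ^ ((n : ℝ) / 2) : ℝ) : ℂ) •
      fun x => (hermiteBase μ n x : ℂ) := by
  funext x
  rw [hermiteFun, genHermite_eq, Pi.smul_apply, smul_eq_mul, ← Complex.ofReal_mul, hermiteBase]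
  congr 1
  have : ((n ! : ℕ) : ℝ) ≠ 0 := by positivity
  field_simp

theorem hermiteBase_mem_hermiteSpan {μ : ℝ} (hμ : -(1 / 2) < μ) (n : ℕ) :
    (fun x => (hermiteBase μ n x : ℂ)) ∈ hermiteSpan μ := by
  have h1 : Real.sqrt (genFactorial μ n / Real.Gamma (μ + 1 / 2)) / 2 ^ ((n : ℝ) / 2) ≠ 0 := by
    have := genFactorial_pos hμ n
    have := Gamma_half_pos hμ
    positivity
  have h2 := (hermiteSpan μ).smul_mem (((Real.sqrt (genFactorial μ n / Real.Gamma (μ + 1 / 2)) /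
    2 ^ ((n : ℝ) / 2) : ℝ) : ℂ)⁻¹) (Submodule.subset_span ⟨n, rfl⟩ : hermiteFun μ n ∈ hermiteSpan μ)
  rwa [hermiteFun_eq, smul_smul, inv_mul_cancel₀ (by exact_mod_cast h1), one_smul] at h2

theorem momentumGraph_eq_span {μ : ℝ} (hμ : -(1 / 2) < μ) :
    momentumGraph μ =
      Submodule.span ℂ (Set.range fun n => (hermiteVec hμ n, momentumVec hμ n)) := by
  have hmem : ∀ n, (hermiteVec hμ n, momentumVec hμ n) ∈ momentumGraph μ := fun n =>
    ⟨_, hermiteBase_mem_hermiteSpan hμ n, coeFn_hermiteVec hμ n, coeFn_momentumVec hμ n⟩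
  have hspan : Submodule.span ℂ (Set.range fun n => (hermiteVec hμ n, momentumVec hμ n)) ≤
      momentumGraph μ := by
    rw [Submodule.span_le]
    rintro _ ⟨n, rfl⟩
    exact hmem n
  refine le_antisymm ?_ hspan
  rintro p ⟨g, hg, h1, h2⟩
  -- It is enough to match first components: the graph is single-valued, so the second components
  -- then agree as well.
  have key : ∃ q ∈ Submodule.span ℂ (Set.range fun n => (hermiteVec hμ n, momentumVec hμ n)),
      q.1 =ᵐ[weightMeasure μ] g := by
    clear h1 h2
    induction hg using Submodule.span_induction with
    | mem x hx =>
      obtain ⟨n, rfl⟩ := hx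
      refine ⟨_, Submodule.smul_mem _ (((Real.sqrt (genFactorial μ n / Real.Gamma (μ + 1 / 2)) /
        2 ^ ((n : ℝ) / 2) : ℝ) : ℂ)) (Submodule.subset_span ⟨n, rfl⟩), ?_⟩
      rw [hermiteFun_eq]
      exact (Lp.coeFn_smul _ _).trans ((coeFn_hermiteVec hμ n).const_smul _)
    | zero => exact ⟨0, zero_mem _, Lp.coeFn_zero _ _ _⟩
    | add x y _ _ hx hy =>
      obtain ⟨q, hq, hq'⟩ := hx
      obtain ⟨r, hr, hr'⟩ := hy
      exact ⟨q + r, add_mem hq hr, (Lp.coeFn_add _ _).trans (hq'.add hr')⟩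
    | smul c x _ hx =>
      obtain ⟨q, hq, hq'⟩ := hx
      exact ⟨c • q, Submodule.smul_mem _ c hq, (Lp.coeFn_smul _ _).trans (hq'.const_smul c)⟩
  obtain ⟨q, hq, hq'⟩ := key
  have h3 : (p - q).2 = 0 := by
    refine momentumGraph_functional μ _ (sub_mem ⟨g, hg, h1, h2⟩ (hspan hq)) ?_
    rw [Prod.fst_sub, sub_eq_zero]
    exact Lp.ext (h1.trans hq'.symm)
  have h4 : p = q := by
    refine Prod.ext (Lp.ext (h1.trans hq'.symm)) ?_
    rwa [Prod.snd_sub, sub_eq_zero] at h3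
  rwa [h4]

theorem momentumGraph_le_mulGraph {μ : ℝ} (hμ : -(1 / 2) < μ) :
    momentumGraph μ ≤ mulGraph (dunklTransform hμ) := by
  rw [momentumGraph_eq_span hμ, Submodule.span_le]
  rintro _ ⟨n, rfl⟩
  rw [SetLike.mem_coe, mem_mulGraph_iff]
  simp only [dunklTransform_hermiteVec]
  filter_upwards [dunklTransform_momentumVec hμ n, coeFn_hermiteVec hμ n,
    Lp.coeFn_smul ((-Complex.I) ^ n) (hermiteVec hμ n)] with x h1 h2 h3
  rw [h1, h3, Pi.smul_apply, h2, smul_eq_mul]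
  ring

/-- Let f be orthogonal to the range and F = Uf. As U carries (P + i)ψ_n to (-i)ⁿ (x + i) ψ_n, the
function (x - i)F is orthogonal to every ψ_n. Hence it vanishes, and x - i has no real zero. -/
theorem dense_momentumGraph_add_I_smul {μ : ℝ} (hμ : -(1 / 2) < μ) :
    Dense {x : L2 μ | ∃ p ∈ momentumGraph μ, p.2 + Complex.I • p.1 = x} := by
  set K : Submodule ℂ (L2 μ) := (momentumGraph μ).map
    (LinearMap.snd ℂ (L2 μ) (L2 μ) + Complex.I • LinearMap.fst ℂ (L2 μ) (L2 μ)) with hK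
  have hKset : {x : L2 μ | ∃ p ∈ momentumGraph μ, p.2 + Complex.I • p.1 = x} = K := rfl
  rw [hKset, Submodule.dense_iff_topologicalClosure_eq_top,
    Submodule.topologicalClosure_eq_top_iff, Submodule.eq_bot_iff]
  intro f hf
  set F := dunklTransform hμ f with hF
  have hmem : ∀ n, momentumVec hμ n + Complex.I • hermiteVec hμ n ∈ K := fun n =>
    ⟨(hermiteVec hμ n, momentumVec hμ n), by
      rw [SetLike.mem_coe, momentumGraph_eq_span hμ]; exact Submodule.subset_span ⟨n, rfl⟩, rfl⟩
  have hmemF := Lp.memLp F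
  have hi : ∀ c : ℝ, Integrable (fun x : ℝ => ((x : ℂ) * F x + -Complex.I * F x) *
      (Real.exp (c * |x| - 1 / 2 * x ^ 2) : ℂ)) (weightMeasure μ) := by
    intro c
    refine ((integrable_ofReal_mul_exp_of_memLp hμ hmemF c).add
      ((integrable_mul_exp_of_memLp hμ hmemF c).const_mul (-Complex.I))).congr
      (Eventually.of_forall fun x => ?_)
    simp only [Pi.add_apply]
    ring
  have hz := ae_eq_zero_of_hermiteBase_orthogonal hμ hi fun n => ?_
  · have hF0 : F = 0 := by
      rw [Lp.eq_zero_iff_ae_eq_zero]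
      filter_upwards [hz] with x hx
      simp only [Pi.zero_apply, ← add_mul] at hx
      refine (mul_eq_zero.1 hx).resolve_left fun h => ?_
      have := congrArg Complex.im h
      simp at this
    rwa [hF, LinearIsometryEquiv.map_eq_zero_iff] at hF0
  · have h1 := (Submodule.mem_orthogonal _ _).1 hf _ (hmem n)
    rw [← (dunklTransform hμ).inner_map_map, ← hF, map_add, map_smul, dunklTransform_hermiteVec,
      L2.inner_def] at h1
    have h2 : (starRingEnd ℂ) ((-Complex.I) ^ n) ≠ 0 := by simp
    refine (mul_eq_zero.1 ?_).resolve_left h2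
    rw [← integral_const_mul, ← h1]
    refine integral_congr_ae ?_
    filter_upwards [dunklTransform_momentumVec hμ n, coeFn_hermiteVec hμ n,
      Lp.coeFn_smul ((-Complex.I) ^ n) (hermiteVec hμ n), Lp.coeFn_smul Complex.I
      ((-Complex.I) ^ n • hermiteVec hμ n), Lp.coeFn_add (dunklTransform hμ (momentumVec hμ n))
      (Complex.I • (-Complex.I) ^ n • hermiteVec hμ n)] with x h3 h4 h5 h6 h7
    rw [h7, Pi.add_apply, h3, h6, Pi.smul_apply, h5, Pi.smul_apply, h4]
    simp only [RCLike.inner_apply, map_add, map_mul, Complex.conj_ofReal, smul_eq_mul, Complex.conj_I]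
    ring

theorem topologicalClosure_momentumGraph {μ : ℝ} (hμ : -(1 / 2) < μ) :
    (momentumGraph μ).topologicalClosure = mulGraph (dunklTransform hμ) :=
  topologicalClosure_eq_mulGraph _ (momentumGraph_le_mulGraph hμ) (dense_momentumGraph_add_I_smul hμ)

theorem momentum_graph {μ : ℝ} (hμ : -(1 / 2) < μ) :
    (momentum μ).graph = mulGraph (dunklTransform hμ) := by
  have hf : ∀ p ∈ mulGraph (dunklTransform hμ), p.1 = 0 → p.2 = 0 := by
    intro p hp h0
    rw [mem_mulGraph_iff, h0, map_zero] at hp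
    rw [← LinearIsometryEquiv.map_eq_zero_iff (dunklTransform hμ), Lp.eq_zero_iff_ae_eq_zero]
    filter_upwards [hp, Lp.coeFn_zero ℂ 2 (weightMeasure μ)] with x h1 h2
    rw [h1, h2]
    simp
  -- `LinearPMap.closure` is the genuine closure only for closable operators; for others it defaults
  -- to the operator itself.
  have hc : (momentumCore μ).IsClosable :=
    ⟨(mulGraph (dunklTransform hμ)).toLinearPMap, by
      rw [momentumCore_graph, topologicalClosure_momentumGraph hμ,
        Submodule.toLinearPMap_graph_eq _ hf]⟩
  rw [momentum, ← hc.graph_closure_eq_closure_graph, momentumCore_graph,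
    topologicalClosure_momentumGraph hμ]

theorem mem_momentum_graph_iff {μ : ℝ} (hμ : -(1 / 2) < μ) (p : L2 μ × L2 μ) :
    p ∈ (momentum μ).graph ↔ dunklTransform hμ p.2 =ᵐ[weightMeasure μ]
      fun y => (y : ℂ) * dunklTransform hμ p.1 y := by
  rw [momentum_graph hμ, mem_mulGraph_iff]

/-! ### The generating functions in `L²` -/

theorem norm_sq_hermiteVec {μ : ℝ} (hμ : -(1 / 2) < μ) (n : ℕ) :
    ‖hermiteVec hμ n‖ ^ 2 = hermiteNormSq μ n := by
  rw [@norm_sq_eq_re_inner ℂ, inner_hermiteVec, if_pos rfl, RCLike.re_to_complex, Complex.ofReal_re]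

/-- Writing |z|ⁿ‖ψ_n‖ = 2⁻ⁿ · (2ⁿ|z|ⁿ‖ψ_n‖) and using ab ≤ a² + b² leaves a geometric series plus
one in ‖ψ_n‖², so no square root of a factorial has to be estimated. -/
theorem summable_norm_pow_smul_hermiteVec {μ : ℝ} (hμ : -(1 / 2) < μ) (z : ℂ) :
    Summable fun n : ℕ => ‖z ^ n • hermiteVec hμ n‖ := by
  obtain ⟨C, hC, h⟩ := exists_inv_genFactorial_le hμ
  have hΓ := Gamma_half_pos hμ
  have h1 : Summable fun n : ℕ => (1 / 4 : ℝ) ^ n :=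
    summable_geometric_of_lt_one (by norm_num) (by norm_num)
  have h2 : Summable fun n : ℕ => Real.Gamma (μ + 1 / 2) * C * ((16 * ‖z‖ ^ 2) ^ n / (n ! : ℝ)) :=
    (Real.summable_pow_div_factorial _).mul_left _
  refine Summable.of_nonneg_of_le (fun _ => norm_nonneg _) (fun n => ?_) (h1.add h2)
  rw [norm_smul, norm_pow]
  have h3 : (4 * ‖z‖ ^ 2) ^ n * hermiteNormSq μ n ≤
      Real.Gamma (μ + 1 / 2) * C * ((16 * ‖z‖ ^ 2) ^ n / (n ! : ℝ)) := by
    have e : (16 * ‖z‖ ^ 2) ^ n = (4 * ‖z‖ ^ 2) ^ n * 2 ^ n * 2 ^ n := by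
      rw [← mul_pow, ← mul_pow]; congr 1; ring
    calc (4 * ‖z‖ ^ 2) ^ n * hermiteNormSq μ n
        = (4 * ‖z‖ ^ 2) ^ n * (Real.Gamma (μ + 1 / 2) * (2 ^ n * (1 / genFactorial μ n))) := by
          rw [hermiteNormSq]; ring
      _ ≤ (4 * ‖z‖ ^ 2) ^ n * (Real.Gamma (μ + 1 / 2) * (2 ^ n * (C * (2 ^ n / (n ! : ℝ))))) := by
          gcongr
          exact h n
      _ = _ := by rw [e]; ring
  have h4 : (1 / 4 : ℝ) ^ n = (1 / 2) ^ n * (1 / 2) ^ n := by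
    rw [← mul_pow]; norm_num
  have h5 : (4 * ‖z‖ ^ 2) ^ n = (2 ^ n * ‖z‖ ^ n) ^ 2 := by
    rw [← mul_pow, ← pow_mul, mul_comm n 2, pow_mul, mul_pow 2 ‖z‖]; norm_num
  have h6 : ((1 : ℝ) / 2) ^ n * 2 ^ n = 1 := by rw [← mul_pow]; norm_num
  rw [← norm_sq_hermiteVec hμ, h5] at h3
  have h7 : ‖z‖ ^ n * ‖hermiteVec hμ n‖ =
      ((1 / 2) ^ n * 2 ^ n) * (‖z‖ ^ n * ‖hermiteVec hμ n‖) := by rw [h6, one_mul]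
  rw [h4, h7]
  nlinarith [sq_nonneg ((1 / 2 : ℝ) ^ n - 2 ^ n * ‖z‖ ^ n * ‖hermiteVec hμ n‖),
    sq_nonneg ((1 / 2 : ℝ) ^ n + 2 ^ n * ‖z‖ ^ n * ‖hermiteVec hμ n‖)]

/-- The generating function `∑ zⁿ ψ_n` as an element of `L2 μ`. -/
def genVec {μ : ℝ} (hμ : -(1 / 2) < μ) (z : ℂ) : L2 μ := ∑' n : ℕ, z ^ n • hermiteVec hμ n

theorem hasSum_genVec {μ : ℝ} (hμ : -(1 / 2) < μ) (z : ℂ) :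
    HasSum (fun n : ℕ => z ^ n • hermiteVec hμ n) (genVec hμ z) :=
  (summable_norm_pow_smul_hermiteVec hμ z).of_norm.hasSum

/-- The generating function `exp (-x² / 2 - z²) e_μ(2 x z)` of the Hermite functions. -/
def genFun (μ : ℝ) (z : ℂ) (x : ℝ) : ℂ :=
  (Real.exp (-x ^ 2 / 2) : ℂ) * (Complex.exp (-z ^ 2) * genExp μ (2 * x * z))

/-- Absolute convergence in L² implies almost everywhere convergence to the L² sum, and the
pointwise sum is known from `hasSum_hermiteCoeff`. -/
theorem coeFn_genVec {μ : ℝ} (hμ : -(1 / 2) < μ) (z : ℂ) :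
    genVec hμ z =ᵐ[weightMeasure μ] genFun μ z := by
  have h1 : ∑' n : ℕ, ‖z ^ n • hermiteVec hμ n‖ₑ ≠ ∞ :=
    tsum_enorm_ne_top_iff_summable_norm.2 (summable_norm_pow_smul_hermiteVec hμ z)
  have h2 : ∀ᵐ x ∂(weightMeasure μ), ∀ n : ℕ, (z ^ n • hermiteVec hμ n : L2 μ) x =
      z ^ n * (hermiteBase μ n x : ℂ) := by
    rw [ae_all_iff]
    intro n
    filter_upwards [Lp.coeFn_smul (z ^ n) (hermiteVec hμ n), coeFn_hermiteVec hμ n] with x h3 h4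
    rw [h3, Pi.smul_apply, h4, smul_eq_mul]
  filter_upwards [Lp.hasSum_coeFn_tsum h1, h2] with x h3 h4
  simp only [h4] at h3
  refine h3.unique ?_
  have h5 := (hasSum_hermiteCoeff hμ z x).mul_left (Real.exp (-x ^ 2 / 2) : ℂ)
  refine Eq.mp (congrArg (fun f => HasSum f _) (funext fun n => ?_)) h5
  rw [hermiteBase]
  push_cast
  ring

theorem conj_genFun (μ : ℝ) (z : ℂ) (x : ℝ) :
    (starRingEnd ℂ) (genFun μ z x) = genFun μ ((starRingEnd ℂ) z) x := by
  simp only [genFun, map_mul, Complex.conj_ofReal, ← Complex.exp_conj, map_neg, map_pow,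
    conj_genExp, map_ofNat]

/-- By orthogonality only the diagonal survives, and ‖ψ_n‖² = Γ(μ+1/2) 2ⁿ/γ(n) makes it a series for
e_μ. -/
theorem inner_genVec {μ : ℝ} (hμ : -(1 / 2) < μ) (w z : ℂ) :
    ⟪genVec hμ w, genVec hμ z⟫_ℂ =
      (Real.Gamma (μ + 1 / 2) : ℂ) * genExp μ (2 * ((starRingEnd ℂ) w * z)) := by
  have h1 : ∀ n : ℕ, ⟪genVec hμ w, hermiteVec hμ n⟫_ℂ =
      (starRingEnd ℂ) w ^ n * (hermiteNormSq μ n : ℂ) := by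
    intro n
    have h2 : HasSum (fun m : ℕ => ⟪hermiteVec hμ n, w ^ m • hermiteVec hμ m⟫_ℂ)
        ⟪hermiteVec hμ n, genVec hμ w⟫_ℂ :=
      (hasSum_genVec hμ w).mapL (innerSL ℂ (hermiteVec hμ n))
    have h3 := hasSum_single (f := fun m : ℕ => ⟪hermiteVec hμ n, w ^ m • hermiteVec hμ m⟫_ℂ) n
      (fun m hm => by
        simp only [inner_smul_right, inner_hermiteVec, if_neg (Ne.symm hm), mul_zero])
    rw [← inner_conj_symm, h2.unique h3, inner_smul_right, inner_hermiteVec, if_pos rfl, map_mul,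
      map_pow, Complex.conj_ofReal]
  have h4 : HasSum (fun n : ℕ => ⟪genVec hμ w, z ^ n • hermiteVec hμ n⟫_ℂ)
      ⟪genVec hμ w, genVec hμ z⟫_ℂ := (hasSum_genVec hμ z).mapL (innerSL ℂ (genVec hμ w))
  refine h4.unique ?_
  have h5 := (hasSum_genExp hμ (2 * ((starRingEnd ℂ) w * z))).mul_left
    (Real.Gamma (μ + 1 / 2) : ℂ)
  refine Eq.mp (congrArg (fun f => HasSum f _) (funext fun n => ?_)) h5
  rw [inner_smul_right, h1, hermiteNormSq, mul_pow, mul_pow]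
  push_cast
  ring

theorem dunklTransform_genVec {μ : ℝ} (hμ : -(1 / 2) < μ) (z : ℂ) :
    dunklTransform hμ (genVec hμ z) = genVec hμ (-Complex.I * z) := by
  have h1 := (hasSum_genVec hμ z).mapL
    ((dunklTransform hμ).toContinuousLinearEquiv : L2 μ →L[ℂ] L2 μ)
  refine h1.unique ?_
  refine Eq.mp (congrArg (fun f => HasSum f _) (funext fun n => ?_))
    (hasSum_genVec hμ (-Complex.I * z))
  change _ = dunklTransform hμ (z ^ n • hermiteVec hμ n)
  rw [map_smul, dunklTransform_hermiteVec, smul_smul, mul_pow, mul_comm]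

/-- z ↦ ⟨f, G_z⟩ is a power series with coefficients ⟨f, ψ_n⟩; if it vanishes identically, so do
they. -/
theorem eq_zero_of_inner_genVec {μ : ℝ} (hμ : -(1 / 2) < μ) {f : L2 μ}
    (hf : ∀ z, ⟪f, genVec hμ z⟫_ℂ = 0) : f = 0 := by
  refine eq_zero_of_inner_hermiteVec hμ fun n => ?_
  set p := FormalMultilinearSeries.ofScalars ℂ fun n : ℕ => ⟪f, hermiteVec hμ n⟫_ℂ with hp
  have h1 : HasFPowerSeriesAt (0 : ℂ → ℂ) p 0 := by
    rw [hasFPowerSeriesAt_iff]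
    refine Eventually.of_forall fun z => ?_
    have h2 : HasSum (fun n : ℕ => ⟪f, z ^ n • hermiteVec hμ n⟫_ℂ) ⟪f, genVec hμ z⟫_ℂ :=
      (hasSum_genVec hμ z).mapL (innerSL ℂ f)
    rw [hf] at h2
    change HasSum _ (0 : ℂ)
    simpa only [inner_smul_right, hp, FormalMultilinearSeries.coeff_ofScalars,
      smul_eq_mul] using h2
  have h3 := congrArg (fun q => FormalMultilinearSeries.coeff q n) h1.eq_zero
  simp only [hp, FormalMultilinearSeries.coeff_ofScalars] at h3
  rw [← inner_conj_symm, h3]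
  simp [FormalMultilinearSeries.coeff]

/-! ### The integral of a Gaussian against two generalized exponentials -/

theorem integral_genFun_mul_genFun {μ : ℝ} (hμ : -(1 / 2) < μ) (w z : ℂ) :
    ∫ x, genFun μ w x * genFun μ z x ∂(weightMeasure μ) =
      (Real.Gamma (μ + 1 / 2) : ℂ) * genExp μ (2 * (w * z)) := by
  have h := inner_genVec hμ ((starRingEnd ℂ) w) z
  rw [Complex.conj_conj, L2.inner_def] at h
  rw [← h]
  refine integral_congr_ae ?_
  filter_upwards [coeFn_genVec hμ ((starRingEnd ℂ) w), coeFn_genVec hμ z] with x h1 h2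
  rw [h1, h2, RCLike.inner_apply, conj_genFun, Complex.conj_conj, mul_comm]

theorem integral_exp_neg_sq_mul_genExp_mul_genExp {μ : ℝ} (hμ : -(1 / 2) < μ) (a b : ℂ) :
    ∫ x : ℝ, (Real.exp (-x ^ 2) : ℂ) * (genExp μ (a * x) * genExp μ (b * x)) ∂(weightMeasure μ) =
      (Real.Gamma (μ + 1 / 2) : ℂ) *
        (Complex.exp ((a ^ 2 + b ^ 2) / 4) * genExp μ (a * b / 2)) := by
  have h := integral_genFun_mul_genFun hμ (a / 2) (b / 2)
  have h1 : ∀ x : ℝ, (Real.exp (-x ^ 2) : ℂ) * (genExp μ (a * x) * genExp μ (b * x)) =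
      Complex.exp ((a ^ 2 + b ^ 2) / 4) * (genFun μ (a / 2) x * genFun μ (b / 2) x) := by
    intro x
    have e1 : 2 * (x : ℂ) * (a / 2) = a * x := by ring
    have e2 : 2 * (x : ℂ) * (b / 2) = b * x := by ring
    have e3 : (Real.exp (-x ^ 2) : ℂ) =
        (Real.exp (-x ^ 2 / 2) : ℂ) * (Real.exp (-x ^ 2 / 2) : ℂ) := by
      rw [← Complex.ofReal_mul, ← Real.exp_add]; congr 2; ring
    have e4 : Complex.exp ((a ^ 2 + b ^ 2) / 4) *
        (Complex.exp (-(a / 2) ^ 2) * Complex.exp (-(b / 2) ^ 2)) = 1 := by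
      rw [← Complex.exp_add, ← Complex.exp_add, ← Complex.exp_zero]; congr 1; ring
    rw [genFun, genFun, e1, e2, e3]
    linear_combination (-(Real.exp (-x ^ 2 / 2) : ℂ) * (Real.exp (-x ^ 2 / 2) : ℂ) *
      genExp μ (a * x) * genExp μ (b * x)) * e4
  simp only [h1]
  rw [integral_const_mul, h, show 2 * (a / 2 * (b / 2)) = a * b / 2 by ring]
  ring

/-- The generalized Weber integral. -/
theorem integral_gaussian_mul_genExp_mul_genExp {μ : ℝ} (hμ : -(1 / 2) < μ) {s : ℝ} (hs : 0 < s)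
    (a b : ℂ) :
    ∫ x : ℝ, (Real.exp (-s * x ^ 2) : ℂ) * (genExp μ (a * x) * genExp μ (b * x))
        ∂(weightMeasure μ) =
      ((Real.Gamma (μ + 1 / 2) * (s ^ (μ + 1 / 2))⁻¹ : ℝ) : ℂ) *
        (Complex.exp ((a ^ 2 + b ^ 2) / (4 * s)) * genExp μ (a * b / (2 * s))) := by
  have hr : 0 < Real.sqrt s := Real.sqrt_pos.2 hs
  have hrr : Real.sqrt s * Real.sqrt s = s := Real.mul_self_sqrt hs.le
  have hrc : (Real.sqrt s : ℂ) ≠ 0 := by exact_mod_cast hr.ne'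
  have hrrc : (Real.sqrt s : ℂ) * Real.sqrt s = s := by exact_mod_cast hrr
  have hp : Real.sqrt s ^ (2 * μ + 1) = s ^ (μ + 1 / 2) := by
    rw [Real.sqrt_eq_rpow, ← Real.rpow_mul hs.le]; congr 1; ring
  -- The substitution x ↦ √s x reduces to s = 1; the weight contributes √s to the power 2μ + 1.
  have h := integral_weightMeasure_comp_mul μ (fun x : ℝ => (Real.exp (-x ^ 2) : ℂ) *
    (genExp μ (a / Real.sqrt s * x) * genExp μ (b / Real.sqrt s * x))) hr
  rw [integral_exp_neg_sq_mul_genExp_mul_genExp hμ, hp] at h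
  have h1 : ∀ x : ℝ, (Real.exp (-(Real.sqrt s * x) ^ 2) : ℂ) *
      (genExp μ (a / Real.sqrt s * (Real.sqrt s * x : ℝ)) *
        genExp μ (b / Real.sqrt s * (Real.sqrt s * x : ℝ))) =
      (Real.exp (-s * x ^ 2) : ℂ) * (genExp μ (a * x) * genExp μ (b * x)) := by
    intro x
    have e1 : -(Real.sqrt s * x) ^ 2 = -s * x ^ 2 := by rw [mul_pow, Real.sq_sqrt hs.le]; ring
    have e2 : ∀ c : ℂ, c / Real.sqrt s * (Real.sqrt s * x : ℝ) = c * x := by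
      intro c; push_cast; field_simp
    rw [e1, e2, e2]
  simp only [h1] at h
  rw [h]
  have e3 : ((a / Real.sqrt s) ^ 2 + (b / Real.sqrt s) ^ 2) / 4 = (a ^ 2 + b ^ 2) / (4 * s) := by
    rw [← hrrc]; field_simp
  have e4 : a / Real.sqrt s * (b / Real.sqrt s) / 2 = a * b / (2 * s) := by
    rw [← hrrc]; field_simp
  rw [e3, e4, Complex.real_smul]
  push_cast
  ring

/-! ### The heat kernel -/

theorem measurable_heatKernel {μ : ℝ} (hμ : -(1 / 2) < μ) (t x : ℝ) :
    Measurable fun y => heatKernel μ t x y := by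
  have := measurable_genExp hμ
  unfold heatKernel
  fun_prop

theorem memLp_heatKernel {μ : ℝ} (hμ : -(1 / 2) < μ) {t : ℝ} (ht : 0 < t) (x : ℝ) :
    MemLp (fun y => heatKernel μ t x y) 2 (weightMeasure μ) := by
  obtain ⟨C, hC, h⟩ := exists_norm_genExp_le hμ
  have hΓ := Gamma_half_pos hμ
  set A : ℝ := 1 / ((4 * t) ^ (μ + 1 / 2) * Real.Gamma (μ + 1 / 2)) with hA
  have hA0 : 0 ≤ A := by positivity
  refine memLp_weight_of_norm_le hμ (s := 1 / (4 * t)) (by positivity) (C := A * C) (c := |x| / t)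
    (measurable_heatKernel hμ t x).aestronglyMeasurable fun y => ?_
  rw [heatKernel, norm_mul, Complex.norm_real, norm_mul, Real.norm_of_nonneg hA0,
    Real.norm_of_nonneg (Real.exp_pos _).le]
  have h1 := h ((x * y / (2 * t) : ℝ) : ℂ)
  have h2 : 2 * ‖((x * y / (2 * t) : ℝ) : ℂ)‖ = |x| / t * |y| := by
    rw [Complex.norm_real, Real.norm_eq_abs, abs_div, abs_mul, abs_of_pos (by positivity : 0 < 2 * t)]
    field_simp
  have h3 : Real.exp (-(x ^ 2 + y ^ 2) / (4 * t)) ≤ Real.exp (-(1 / (4 * t) * y ^ 2)) := by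
    rw [Real.exp_le_exp, neg_div, neg_le_neg_iff, one_div_mul_eq_div]
    gcongr
    nlinarith [sq_nonneg x]
  rw [h2] at h1
  calc _ ≤ A * Real.exp (-(1 / (4 * t) * y ^ 2)) * (C * Real.exp (|x| / t * |y|)) := by gcongr
    _ = A * C * (Real.exp (|x| / t * |y|) * Real.exp (-(1 / (4 * t) * y ^ 2))) := by ring
    _ = _ := by rw [← Real.exp_add]; congr 2

theorem conj_heatKernel (μ t x y : ℝ) :
    (starRingEnd ℂ) (heatKernel μ t x y) = heatKernel μ t x y := by
  rw [heatKernel, map_mul, conj_genExp, Complex.conj_ofReal, Complex.conj_ofReal]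

theorem heatIntegrand_eq (μ t : ℝ) (f : ℝ → ℂ) (x y : ℝ) :
    heatIntegrand μ t f x y = |y| ^ (2 * μ) • (heatKernel μ t x y * f y) := by
  rw [heatIntegrand, Complex.real_smul, mul_comm]

theorem integrable_heatIntegrand {μ : ℝ} (hμ : -(1 / 2) < μ) {t : ℝ} (ht : 0 < t) (f : L2 μ)
    (x : ℝ) : Integrable fun y => heatIntegrand μ t f x y := by
  simp only [heatIntegrand_eq]
  rw [← integrable_weightMeasure_iff]
  exact (memLp_heatKernel hμ ht x).integrable_mul (Lp.memLp f)

/-- The heat kernel `y ↦ K(x, y)` as an element of `L2 μ`. -/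
def heatVec {μ : ℝ} (hμ : -(1 / 2) < μ) {t : ℝ} (ht : 0 < t) (x : ℝ) : L2 μ :=
  (memLp_heatKernel hμ ht x).toLp _

theorem heatOperator_eq_integral (μ t : ℝ) (f : ℝ → ℂ) (x : ℝ) :
    heatOperator μ t f x = ∫ y, heatKernel μ t x y * f y ∂(weightMeasure μ) := by
  rw [heatOperator, integral_weightMeasure]
  simp only [heatIntegrand_eq]

/-- The kernel is real, so no conjugate appears. In this form the value at each fixed x is
continuous in f. -/
theorem heatOperator_eq_inner {μ : ℝ} (hμ : -(1 / 2) < μ) {t : ℝ} (ht : 0 < t) (f : L2 μ) (x : ℝ) :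
    heatOperator μ t f x = ⟪heatVec hμ ht x, f⟫_ℂ := by
  rw [heatOperator_eq_integral, L2.inner_def]
  refine integral_congr_ae ?_
  filter_upwards [(memLp_heatKernel hμ ht x).coeFn_toLp] with y hy
  rw [heatVec, hy, RCLike.inner_apply, conj_heatKernel, mul_comm]

/-! ### The heat operator on the generating functions -/

/-- The function to which the heat operator maps `genFun μ z`. -/
def heatGenFun (μ t : ℝ) (z : ℂ) (x : ℝ) : ℂ :=
  ((((1 + 2 * t) ^ (μ + 1 / 2))⁻¹ : ℝ) : ℂ) * Complex.exp (z ^ 2 * (2 * t - 1) / (1 + 2 * t)) *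
    ((Real.exp (-(1 / (2 * (1 + 2 * t))) * x ^ 2) : ℂ) * genExp μ (2 * z / (1 + 2 * t) * x))

theorem heatOperator_genVec {μ : ℝ} (hμ : -(1 / 2) < μ) {t : ℝ} (ht : 0 < t) (z : ℂ) (x : ℝ) :
    heatOperator μ t (genVec hμ z) x = heatGenFun μ t z x := by
  have hΓ := Gamma_half_pos hμ
  have h2t : 0 < 1 + 2 * t := by linarith
  have htc : (t : ℂ) ≠ 0 := by exact_mod_cast ht.ne'
  have h2tc : (1 + 2 * t : ℂ) ≠ 0 := by exact_mod_cast h2t.ne'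
  -- s = 1/(4t) + 1/2 collects the Gaussian factors in y of the kernel and of G_z; the Weber
  -- integral is then taken with a = x/(2t) and b = 2z.
  set s : ℝ := (1 + 2 * t) / (4 * t) with hs
  have hs0 : 0 < s := by positivity
  have h1 : heatOperator μ t (genVec hμ z) x =
      ∫ y : ℝ, (((1 / ((4 * t) ^ (μ + 1 / 2) * Real.Gamma (μ + 1 / 2)) *
        Real.exp (-x ^ 2 / (4 * t)) : ℝ) : ℂ) * Complex.exp (-z ^ 2)) *
        ((Real.exp (-s * y ^ 2) : ℂ) * (genExp μ (((x / (2 * t) : ℝ) : ℂ) * y) *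
          genExp μ (2 * z * y))) ∂(weightMeasure μ) := by
    rw [heatOperator_eq_integral]
    refine integral_congr_ae ?_
    filter_upwards [coeFn_genVec hμ z] with y hy
    have e1 : ((x * y / (2 * t) : ℝ) : ℂ) = ((x / (2 * t) : ℝ) : ℂ) * y := by
      push_cast; ring
    have e2 : 2 * (y : ℂ) * z = 2 * z * y := by ring
    have e3 : (Real.exp (-(x ^ 2 + y ^ 2) / (4 * t)) : ℂ) * (Real.exp (-y ^ 2 / 2) : ℂ) =
        (Real.exp (-x ^ 2 / (4 * t)) : ℂ) * (Real.exp (-s * y ^ 2) : ℂ) := by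
      rw [← Complex.ofReal_mul, ← Complex.ofReal_mul, ← Real.exp_add, ← Real.exp_add, hs]
      congr 2
      field_simp
      ring
    rw [hy, heatKernel, genFun, e1, e2, Complex.ofReal_mul, Complex.ofReal_mul]
    linear_combination (((1 / ((4 * t) ^ (μ + 1 / 2) * Real.Gamma (μ + 1 / 2)) : ℝ) : ℂ) *
      Complex.exp (-z ^ 2) * genExp μ (((x / (2 * t) : ℝ) : ℂ) * y) * genExp μ (2 * z * y)) * e3
  rw [h1, integral_const_mul, integral_gaussian_mul_genExp_mul_genExp hμ hs0, heatGenFun]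
  have c1 : 1 / ((4 * t) ^ (μ + 1 / 2) * Real.Gamma (μ + 1 / 2)) *
      (Real.Gamma (μ + 1 / 2) * (s ^ (μ + 1 / 2))⁻¹) = ((1 + 2 * t) ^ (μ + 1 / 2))⁻¹ := by
    have p1 : 0 < (4 * t) ^ (μ + 1 / 2) := by positivity
    have p2 : 0 < (1 + 2 * t) ^ (μ + 1 / 2) := by positivity
    rw [hs, Real.div_rpow h2t.le (by positivity)]
    generalize Real.Gamma (μ + 1 / 2) = G at hΓ ⊢
    field_simp
  have c2 : ((x / (2 * t) : ℝ) : ℂ) * (2 * z) / (2 * (s : ℂ)) = 2 * z / (1 + 2 * t) * x := by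
    rw [hs]; push_cast; field_simp; ring
  have c3 : (Real.exp (-x ^ 2 / (4 * t)) : ℂ) * (Complex.exp (-z ^ 2) *
      Complex.exp ((((x / (2 * t) : ℝ) : ℂ) ^ 2 + (2 * z) ^ 2) / (4 * (s : ℂ)))) =
      Complex.exp (z ^ 2 * (2 * t - 1) / (1 + 2 * t)) *
        (Real.exp (-(1 / (2 * (1 + 2 * t))) * x ^ 2) : ℂ) := by
    rw [Complex.ofReal_exp, Complex.ofReal_exp, ← Complex.exp_add, ← Complex.exp_add,
      ← Complex.exp_add]
    congr 1
    have e1 : (((x / (2 * t) : ℝ) : ℂ) ^ 2 + (2 * z) ^ 2) / (4 * (s : ℂ)) =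
        (((x : ℂ) * (t : ℂ)⁻¹) ^ 2 / 4 + 4 * z ^ 2) * (t * (1 + 2 * (t : ℂ))⁻¹) := by
      rw [hs]; push_cast; field_simp; ring
    have e2 : 1 / (2 * (1 + 2 * (t : ℂ))) = (1 + 2 * (t : ℂ))⁻¹ / 2 := by field_simp
    rw [e1]
    push_cast
    rw [e2]
    have i1 := inv_mul_cancel₀ htc
    have i2 := inv_mul_cancel₀ h2tc
    linear_combination ((x : ℂ) ^ 2 * (t : ℂ)⁻¹ / 4 + z ^ 2) * i2 +
      ((x : ℂ) ^ 2 * (t : ℂ)⁻¹ * (1 + 2 * (t : ℂ))⁻¹ / 4 -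
        (x : ℂ) ^ 2 * (1 + 2 * (t : ℂ))⁻¹ / 2) * i1
  rw [c2, ← c1, Complex.ofReal_mul _ (Real.exp _), Complex.ofReal_mul
    (1 / ((4 * t) ^ (μ + 1 / 2) * Real.Gamma (μ + 1 / 2)))]
  linear_combination (((1 / ((4 * t) ^ (μ + 1 / 2) * Real.Gamma (μ + 1 / 2)) : ℝ) : ℂ) *
    ((Real.Gamma (μ + 1 / 2) * (s ^ (μ + 1 / 2))⁻¹ : ℝ) : ℂ) *
    genExp μ (2 * z / (1 + 2 * t) * x)) * c3

theorem memLp_heatGenFun {μ : ℝ} (hμ : -(1 / 2) < μ) {t : ℝ} (ht : 0 < t) (z : ℂ) :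
    MemLp (heatGenFun μ t z) 2 (weightMeasure μ) := by
  obtain ⟨C, hC, h⟩ := exists_norm_genExp_le hμ
  refine MemLp.const_mul (f := fun x : ℝ => ((Real.exp (-(1 / (2 * (1 + 2 * t))) * x ^ 2) : ℂ) *
    genExp μ (2 * z / (1 + 2 * t) * x))) ?_ _
  have hm := measurable_genExp hμ
  refine memLp_weight_of_norm_le hμ (s := 1 / (2 * (1 + 2 * t))) (by positivity) (C := C)
    (c := 2 * ‖2 * z / (1 + 2 * t)‖) (Measurable.aestronglyMeasurable (by fun_prop)) fun x => ?_
  have h1 := h (2 * z / (1 + 2 * t) * x)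
  rw [norm_mul, Complex.norm_real, Real.norm_of_nonneg (Real.exp_pos _).le]
  rw [norm_mul _ (x : ℂ), Complex.norm_real, Real.norm_eq_abs, ← mul_assoc] at h1
  calc _ ≤ Real.exp (-(1 / (2 * (1 + 2 * t))) * x ^ 2) *
        (C * Real.exp (2 * ‖2 * z / (1 + 2 * t)‖ * |x|)) := by gcongr
    _ = _ := by
      rw [mul_left_comm, ← Real.exp_add]
      congr 2
      ring

/-- The right side pairs the transforms of the generating functions: U G_z = G_{-iz}, and
conjugating the left argument of the inner product turns -i into i. Two Weber integrals give the
common value Γ(μ+1/2) (1+t)^(-μ-1/2) exp(t(w²+z²)/(1+t)) e_μ(2wz/(1+t)). -/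
theorem integral_genFun_mul_heatGenFun {μ : ℝ} (hμ : -(1 / 2) < μ) {t : ℝ} (ht : 0 < t)
    (w z : ℂ) :
    ∫ x, genFun μ w x * heatGenFun μ t z x ∂(weightMeasure μ) =
      ∫ x : ℝ, genFun μ (Complex.I * w) x * ((Real.exp (-t * x ^ 2) : ℂ) *
        genFun μ (-Complex.I * z) x) ∂(weightMeasure μ) := by
  have h1t : 0 < 1 + t := by linarith
  have h2t : 0 < 1 + 2 * t := by linarith
  have h1tc : (1 + t : ℂ) ≠ 0 := by exact_mod_cast h1t.ne'
  have h2tc : (1 + 2 * t : ℂ) ≠ 0 := by exact_mod_cast h2t.ne'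
  -- The sum of 1/2, from G_w, and 1/(2(1+2t)), from `heatGenFun`.
  set s : ℝ := (1 + t) / (1 + 2 * t) with hs
  have hs0 : 0 < s := by positivity
  have hl : ∀ x : ℝ, genFun μ w x * heatGenFun μ t z x =
      (((((1 + 2 * t) ^ (μ + 1 / 2))⁻¹ : ℝ) : ℂ) *
        (Complex.exp (z ^ 2 * (2 * t - 1) / (1 + 2 * t)) * Complex.exp (-w ^ 2))) *
      ((Real.exp (-s * x ^ 2) : ℂ) *
        (genExp μ (2 * w * x) * genExp μ (2 * z / (1 + 2 * t) * x))) := by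
    intro x
    have e1 : (Real.exp (-x ^ 2 / 2) : ℂ) * (Real.exp (-(1 / (2 * (1 + 2 * t))) * x ^ 2) : ℂ) =
        (Real.exp (-s * x ^ 2) : ℂ) := by
      rw [← Complex.ofReal_mul, ← Real.exp_add, hs]
      congr 2
      field_simp
      ring
    rw [genFun, heatGenFun, ← e1, show 2 * (x : ℂ) * w = 2 * w * x by ring]
    ring
  have hr : ∀ x : ℝ, genFun μ (Complex.I * w) x * ((Real.exp (-t * x ^ 2) : ℂ) *
      genFun μ (-Complex.I * z) x) = (Complex.exp (w ^ 2) * Complex.exp (z ^ 2)) *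
      ((Real.exp (-(1 + t) * x ^ 2) : ℂ) *
        (genExp μ (2 * (Complex.I * w) * x) * genExp μ (2 * (-Complex.I * z) * x))) := by
    intro x
    have e1 : (Real.exp (-(1 + t) * x ^ 2) : ℂ) = (Real.exp (-x ^ 2 / 2) : ℂ) *
        (Real.exp (-t * x ^ 2) : ℂ) * (Real.exp (-x ^ 2 / 2) : ℂ) := by
      rw [← Complex.ofReal_mul, ← Complex.ofReal_mul, ← Real.exp_add, ← Real.exp_add]
      congr 2
      ring
    have e2 : -(Complex.I * w) ^ 2 = w ^ 2 := by
      rw [mul_pow, Complex.I_sq]; ring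
    have e3 : -(-Complex.I * z) ^ 2 = z ^ 2 := by
      rw [mul_pow, neg_sq, Complex.I_sq]; ring
    rw [genFun, genFun, e1, e2, e3, show 2 * (x : ℂ) * (Complex.I * w) = 2 * (Complex.I * w) * x by
      ring, show 2 * (x : ℂ) * (-Complex.I * z) = 2 * (-Complex.I * z) * x by ring]
    ring
  simp only [hl, hr]
  rw [integral_const_mul, integral_const_mul, integral_gaussian_mul_genExp_mul_genExp hμ hs0,
    integral_gaussian_mul_genExp_mul_genExp hμ h1t]
  have c1 : ((1 + 2 * t) ^ (μ + 1 / 2))⁻¹ * (Real.Gamma (μ + 1 / 2) * (s ^ (μ + 1 / 2))⁻¹) =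
      Real.Gamma (μ + 1 / 2) * ((1 + t) ^ (μ + 1 / 2))⁻¹ := by
    have p1 : 0 < (1 + t) ^ (μ + 1 / 2) := by positivity
    have p2 : 0 < (1 + 2 * t) ^ (μ + 1 / 2) := by positivity
    rw [hs, Real.div_rpow h1t.le h2t.le]
    field_simp
  have c2 : 2 * w * (2 * z / (1 + 2 * t)) / (2 * (s : ℂ)) =
      2 * (Complex.I * w) * (2 * (-Complex.I * z)) / (2 * ((1 + t : ℝ) : ℂ)) := by
    rw [hs]
    push_cast
    field_simp
    rw [Complex.I_sq]
    ring
  have c3 : Complex.exp (z ^ 2 * (2 * t - 1) / (1 + 2 * t)) * Complex.exp (-w ^ 2) *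
      Complex.exp (((2 * w) ^ 2 + (2 * z / (1 + 2 * t)) ^ 2) / (4 * (s : ℂ))) =
      Complex.exp (w ^ 2) * Complex.exp (z ^ 2) * Complex.exp (((2 * (Complex.I * w)) ^ 2 +
        (2 * (-Complex.I * z)) ^ 2) / (4 * ((1 + t : ℝ) : ℂ))) := by
    rw [← Complex.exp_add, ← Complex.exp_add, ← Complex.exp_add, ← Complex.exp_add, hs]
    congr 1
    have e4 : (2 * (Complex.I * w)) ^ 2 + (2 * (-Complex.I * z)) ^ 2 = -(4 * (w ^ 2 + z ^ 2)) := by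
      linear_combination (4 * w ^ 2 + 4 * z ^ 2) * Complex.I_sq
    rw [e4]
    push_cast
    field_simp
    ring
  have c1c := congrArg (fun r : ℝ => (r : ℂ)) c1
  simp only [Complex.ofReal_mul ((1 + 2 * t) ^ (μ + 1 / 2))⁻¹] at c1c
  rw [c2, ← c1c]
  linear_combination (((((1 + 2 * t) ^ (μ + 1 / 2))⁻¹ : ℝ) : ℂ) *
    ((Real.Gamma (μ + 1 / 2) * (s ^ (μ + 1 / 2))⁻¹ : ℝ) : ℂ) *
    genExp μ (2 * (Complex.I * w) * (2 * (-Complex.I * z)) / (2 * ((1 + t : ℝ) : ℂ)))) * c3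

/-! ### The heat semigroup -/

theorem measurable_exp_neg_mul_sq (t : ℝ) : Measurable fun l : ℝ => Real.exp (-t * l ^ 2) := by
  fun_prop

theorem abs_exp_neg_mul_sq_le {t : ℝ} (ht : 0 ≤ t) (l : ℝ) : |Real.exp (-t * l ^ 2)| ≤ 1 := by
  rw [Real.abs_exp, Real.exp_le_one_iff]
  nlinarith [mul_nonneg ht (sq_nonneg l)]

/-- The operators `exp (-t P²)`. -/
def heatSemigroup {μ : ℝ} (hμ : -(1 / 2) < μ) (t : ℝ) : L2 μ →L[ℂ] L2 μ :=
  transportMul (dunklTransform hμ) fun l => Real.exp (-t * l ^ 2)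

theorem heatSemigroup_genVec {μ : ℝ} (hμ : -(1 / 2) < μ) {t : ℝ} (ht : 0 < t) (z : ℂ) :
    heatSemigroup hμ t (genVec hμ z) = (memLp_heatGenFun hμ ht z).toLp _ := by
  rw [← sub_eq_zero]
  refine eq_zero_of_inner_genVec hμ fun w => ?_
  rw [← inner_conj_symm, inner_sub_right, map_eq_zero, sub_eq_zero, heatSemigroup,
    transportMul_apply, inner_symm_right, dunklTransform_genVec, dunklTransform_genVec,
    L2.inner_def, L2.inner_def]
  have h := integral_genFun_mul_heatGenFun hμ ht ((starRingEnd ℂ) w) z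
  have hl : ∫ x, ⟪genVec hμ w x, (memLp_heatGenFun hμ ht z).toLp _ x⟫_ℂ ∂(weightMeasure μ) =
      ∫ x, genFun μ ((starRingEnd ℂ) w) x * heatGenFun μ t z x ∂(weightMeasure μ) := by
    refine integral_congr_ae ?_
    filter_upwards [coeFn_genVec hμ w, (memLp_heatGenFun hμ ht z).coeFn_toLp] with x h1 h2
    rw [h1, h2, RCLike.inner_apply, conj_genFun, mul_comm]
  rw [hl, h]
  refine integral_congr_ae ?_
  filter_upwards [coeFn_genVec hμ (-Complex.I * w), coeFn_genVec hμ (-Complex.I * z),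
    coeFn_mulOp (measurable_exp_neg_mul_sq t) (abs_exp_neg_mul_sq_le ht.le)
      (genVec hμ (-Complex.I * z))] with x h1 h2 h3
  rw [h1, h3, h2, RCLike.inner_apply, conj_genFun, map_mul, map_neg, Complex.conj_I, neg_neg,
    mul_comm]

/-- The subspace on which the integral operator agrees with the semigroup. -/
def heatAgree {μ : ℝ} (hμ : -(1 / 2) < μ) {t : ℝ} (ht : 0 < t) : Submodule ℂ (L2 μ) where
  carrier := {f | (fun x => ⟪heatVec hμ ht x, f⟫_ℂ) =ᵐ[weightMeasure μ] heatSemigroup hμ t f}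
  add_mem' := by
    intro f g hf hg
    simp only [Set.mem_ofPred_eq] at hf hg ⊢
    filter_upwards [hf, hg, Lp.coeFn_add (heatSemigroup hμ t f) (heatSemigroup hμ t g)]
      with x h1 h2 h3
    rw [map_add, h3, Pi.add_apply, inner_add_right, h1, h2]
  zero_mem' := by
    simp only [Set.mem_ofPred_eq, map_zero, inner_zero_right]
    exact (Lp.coeFn_zero ℂ 2 (weightMeasure μ)).symm
  smul_mem' := by
    intro c f hf
    simp only [Set.mem_ofPred_eq] at hf ⊢
    filter_upwards [hf, Lp.coeFn_smul c (heatSemigroup hμ t f)] with x h1 h2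
    rw [map_smul, h2, Pi.smul_apply, inner_smul_right, h1, smul_eq_mul]

/-- Along a convergent sequence the inner products converge at every x, while the images under the
semigroup converge in L² and hence almost everywhere on a subsequence; the limits must agree. -/
theorem isClosed_heatAgree {μ : ℝ} (hμ : -(1 / 2) < μ) {t : ℝ} (ht : 0 < t) :
    IsClosed (heatAgree hμ ht : Set (L2 μ)) := by
  refine IsSeqClosed.isClosed fun u f hu hlim => ?_
  have h1 : Tendsto (fun n => heatSemigroup hμ t (u n)) atTop (𝓝 (heatSemigroup hμ t f)) :=
    ((heatSemigroup hμ t).continuous.tendsto f).comp hlim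
  obtain ⟨ns, hns, hae⟩ := (tendstoInMeasure_of_tendsto_Lp h1).exists_seq_tendsto_ae
  have h2 : ∀ᵐ x ∂(weightMeasure μ), ∀ n,
      ⟪heatVec hμ ht x, u n⟫_ℂ = heatSemigroup hμ t (u n) x := ae_all_iff.2 hu
  change (fun x => ⟪heatVec hμ ht x, f⟫_ℂ) =ᵐ[weightMeasure μ] heatSemigroup hμ t f
  filter_upwards [hae, h2] with x h3 h4
  refine tendsto_nhds_unique ?_ h3
  have h5 : Tendsto (fun i => ⟪heatVec hμ ht x, u (ns i)⟫_ℂ) atTop (𝓝 ⟪heatVec hμ ht x, f⟫_ℂ) :=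
    (tendsto_const_nhds.inner hlim).comp hns.tendsto_atTop
  simpa only [h4] using h5

theorem heatAgree_eq_top {μ : ℝ} (hμ : -(1 / 2) < μ) {t : ℝ} (ht : 0 < t) :
    heatAgree hμ ht = ⊤ := by
  have h1 : Submodule.span ℂ (Set.range (genVec hμ)) ≤ heatAgree hμ ht := by
    rw [Submodule.span_le]
    rintro _ ⟨z, rfl⟩
    change (fun x => ⟪heatVec hμ ht x, genVec hμ z⟫_ℂ) =ᵐ[weightMeasure μ]
      heatSemigroup hμ t (genVec hμ z)
    rw [heatSemigroup_genVec hμ ht]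
    filter_upwards [(memLp_heatGenFun hμ ht z).coeFn_toLp] with x hx
    rw [hx, ← heatOperator_eq_inner, heatOperator_genVec hμ ht]
  have h2 : (Submodule.span ℂ (Set.range (genVec hμ))).topologicalClosure = ⊤ := by
    rw [Submodule.topologicalClosure_eq_top_iff, Submodule.eq_bot_iff]
    intro f hf
    refine eq_zero_of_inner_genVec hμ fun z => ?_
    exact (Submodule.mem_orthogonal' _ _).1 hf _ (Submodule.subset_span ⟨z, rfl⟩)
  rw [eq_top_iff, ← h2]
  exact Submodule.topologicalClosure_minimal _ h1 (isClosed_heatAgree hμ ht)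

theorem heatOperator_ae_eq_heatSemigroup {μ : ℝ} (hμ : -(1 / 2) < μ) {t : ℝ} (ht : 0 < t)
    (f : L2 μ) : heatOperator μ t f =ᵐ[weightMeasure μ] heatSemigroup hμ t f := by
  have h : f ∈ heatAgree hμ ht := by rw [heatAgree_eq_top]; trivial
  refine EventuallyEq.trans (Eventually.of_forall fun x => ?_) h
  exact heatOperator_eq_inner hμ ht f x

theorem heatSemigroup_add {μ : ℝ} (hμ : -(1 / 2) < μ) {s t : ℝ} (hs : 0 < s) (ht : 0 < t) :
    heatSemigroup hμ (s + t) = (heatSemigroup hμ s).comp (heatSemigroup hμ t) := by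
  refine ContinuousLinearMap.ext fun f => ?_
  rw [ContinuousLinearMap.comp_apply, heatSemigroup, heatSemigroup, heatSemigroup,
    transportMul_transportMul _ (measurable_exp_neg_mul_sq s) (abs_exp_neg_mul_sq_le hs.le)
    (measurable_exp_neg_mul_sq t) (abs_exp_neg_mul_sq_le ht.le)]
  congr 2
  funext l
  rw [← Real.exp_add]
  congr 1
  ring

theorem tendsto_heatSemigroup {μ : ℝ} (hμ : -(1 / 2) < μ) (f : L2 μ) :
    Tendsto (fun t => heatSemigroup hμ t f) (𝓝[>] 0) (𝓝 f) := by
  have h := tendsto_transportMul (dunklTransform hμ) (l := 𝓝[>] (0 : ℝ)) (C := 1)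
    (m := fun t l => Real.exp (-t * l ^ 2)) (k := fun _ => 1)
    measurable_exp_neg_mul_sq ?_ measurable_const (by simp) (fun l => ?_) f
  · rwa [transportMul_apply _ (fun _ => 1), mulOp_one, LinearIsometryEquiv.symm_apply_apply] at h
  -- The uniform bound 1 needs t ≥ 0, so it holds only eventually in the right-sided filter.
  · filter_upwards [self_mem_nhdsWithin] with t ht
    exact abs_exp_neg_mul_sq_le (le_of_lt ht)
  · have hc : Continuous fun t : ℝ => Real.exp (-t * l ^ 2) := by fun_prop
    have := hc.tendsto 0
    simp only [neg_zero, zero_mul, Real.exp_zero] at this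
    exact this.mono_left nhdsWithin_le_nhds

end BoseLike

end

/-! ### The main theorem -/

theorem theorem3p10 (μ : ℝ) (hμ : -(1 / 2) < μ) :
    IsSelfAdjoint (BoseLike.momentum μ) ∧
    ∃ S : ℝ → BoseLike.L2 μ →L[ℂ] BoseLike.L2 μ,
      (∀ t : ℝ, 0 < t →
        IsBorelFunctionOf (BoseLike.momentum μ) (fun l => Real.exp (-t * l ^ 2)) (S t)) ∧
      (∀ t : ℝ, 0 < t → ∀ f : BoseLike.L2 μ,
        (∀ x : ℝ, Integrable (fun y => BoseLike.heatIntegrand μ t f x y)) ∧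
        BoseLike.heatOperator μ t f =ᵐ[BoseLike.weightMeasure μ] S t f) ∧
      (∀ s t : ℝ, 0 < s → 0 < t → S (s + t) = (S s).comp (S t)) ∧
      (∀ f : BoseLike.L2 μ, Tendsto (fun t => S t f) (𝓝[>] 0) (𝓝 f)) := by
  have hgraph := BoseLike.mem_momentum_graph_iff hμ
  refine ⟨isSelfAdjoint_of_mem_graph_iff hgraph, BoseLike.heatSemigroup hμ, fun t ht => ?_,
    fun t ht f => ?_, fun s t hs ht => BoseLike.heatSemigroup_add hμ hs ht,
    BoseLike.tendsto_heatSemigroup hμ⟩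
  · exact ⟨spectralMeasureOfUnitary (BoseLike.dunklTransform hμ),
      isSpectralMeasureOf_of_mem_graph_iff hgraph,
      isIntegral_transportMul _ (BoseLike.measurable_exp_neg_mul_sq t)
        (BoseLike.abs_exp_neg_mul_sq_le ht.le)⟩
  · exact ⟨BoseLike.integrable_heatIntegrand hμ ht f,
      BoseLike.heatOperator_ae_eq_heatSemigroup hμ ht f⟩
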